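/- Let $k$ be a field of characteristic $0$, $C$ a set of colours and $\mathcal A$ a non-symmetric graded $C$-coloured operad over $k$ with zero differential. Let $\rho\colon\mathcal R=(\mathbb F(X),\partial)\to(\mathcal A,0)$ be a $TJ$-graded free resolution: $\rho$ is a morphism of dg operads inducing an isomorphism on homology, the graded collection $X=\bigoplus_{i\ge 0}X^i$ carries an additional ($TJ$-)grading such that, for the induced grading $\mathcal R=\bigoplus_i\mathcal R^i$, $\partial$ lowers the $TJ$-degree by one (so $\partial X^i\subset\mathbb F(\bigoplus_{j<i}X^j)$), $\rho(X^i)=0$ for $i>0$, and $H_0(\mathcal R^*,\partial)\to\mathcal A$ is an isomorphism. Let $A=(A_c)_{c\in C}$ be a family of graded vector spaces (with zero differential) with an $\mathcal A$-algebra structure $\alpha\colon\mathcal A\to\mathcal E nd_A$. Let $\Phi$ be spanned by elements $\phi_c$ of colours $\binom cc$ and degree $0$, let $\underline X=\uparrow X$ be the suspension of $X$, with elements $\underline x$ of degree $|x|+1$, and let $\mathcal{DR}=\mathbb F(X\oplus\Phi\oplus\underline X)$ with the derivation differential $x\mapsto\partial x$, $\phi_c\mapsto0$, $\underline x\mapsto\phi\circ_1x-\sum_i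 x\circ_i\phi-s(\partial x)$, where $s\colon\mathbb F(X)\to\mathcal{DR}$ is the degree $1$ derivation with $s(x)=\underline x$. It lies over $\mathcal A$ by $\rho$ on $X$ and $0$ on the other generators. The $TJ$-degree of $\phi_c$ is $0$, that of $\underline x$ is $i+1$ for $x\in X^i$. Put $\delta\theta=\theta\circ\partial$. For $n,w\in\mathbb Z$ let ${}^{TJ}C^{n}_{aug}(A,A)_w$ be the space of derivations $\theta\colon\mathcal{DR}\to\mathcal E nd_A$ over $\mathcal A$ of degree $w-n$ that vanish on $X$ and on all generators of $TJ$-degree $\ne n$, and let ${}^{TJ}C^{n}(A,A)_w$ be the space of derivations $\theta\colon\mathcal R\to\mathcal E nd_A$ over $\mathcal A$ of degree $w-(n-1)$ that vanish on $X^j$ for $j\neq n-1$. The internal degree $w$ is preserved by $\delta$, and ${}^{TJ}C^n_{aug}(A,A)=\bigoplus_w{}^{TJ}C^{n}_{aug}(A,A)_w$, ${}^{TJ}C^n(A,A)=\bigoplus_w{}^{TJ}C^{n}(A,A)_w$. Then, for each $w$, both are cochain complexes with differential $\delta$, and their cohomologies ${}^{TJ}H^n_{aug}(A,A)_w$, ${}^{TJ}H^n(A,A)_w$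 satisfy: 1. ${}^{TJ}C^n_{aug}(A,A)_w=0$ for $n\le-1$. 2. ${}^{TJ}C^0_{aug}(A,A)_w$ is the space of all degree $w$ derivations $\mathcal{DR}\to\mathcal E nd_A$ over $\mathcal A$ vanishing on $X\oplus\underline X$, and $\theta\mapsto(\theta(\phi_c))_c$ is an isomorphism onto the space $\prod_{c}\mathrm{Hom}_k(A_c,A_c)_w$ of colour preserving linear maps $A\to A$ of degree $w$. 3. Let $\varepsilon$ be a parameter of degree $-w$ with $\varepsilon^2=0$ (for $w=0$ this is the usual $k[\varepsilon]/(\varepsilon^2)$). Formal infinitesimal deformations of $\alpha$ are the maps $D\colon\mathcal A\to\mathcal E nd_A$ of degree $w$ such that $\alpha+\varepsilon D\colon\mathcal A\to\mathcal E nd_A\otimes k[\varepsilon]/(\varepsilon^2)$ is a morphism of operads; $D$ and $D'$ are related by an infinitesimal automorphism $1+\varepsilon h$, where $h=(h_c\colon A_c\to A_c)_c$ has degree $w$, if $(1+\varepsilon h)\circ(\alpha+\varepsilon D)(a)=(\alpha+\varepsilon D')(a)\circ(1+\varepsilon h,\dots,1+\varepsilon h)$ for all $a$. Two deformations are related by an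 infinitesimal automorphism if and only if they agree modulo the submodule generated by the differences of related deformations, and ${}^{TJ}H^1_{aug}(A,A)_w$ is isomorphic to the quotient of the $k$-module of deformations by this submodule. The isomorphism sends the class of $\theta$ to the class of the deformation $D$ with $D(\rho(x))=\theta(\underline x)$ for all $x\in X$. 4. ${}^{TJ}H^n_{aug}(A,A)_w\cong{}^{TJ}H^n(A,A)_w$ for $n\ge2$. The isomorphism sends the class of $\theta$ to the class of the derivation $\theta'$ with $\theta'(x)=\theta(\underline x)$ for all $x\in X$. -/

import Mathlib

universe u v w x y

noncomputable section

/-! ## Graded coloured operads -/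

/-- The Koszul sign `(-1)^n` as a scalar. -/
def ksgn (k : Type u) [Field k] (n : ℤ) : k := ((n.negOnePow : ℤ) : k)

theorem ksgn_zero (k : Type u) [Field k] : ksgn k 0 = 1 := by
  simp [ksgn]

theorem ksgn_add (k : Type u) [Field k] (m n : ℤ) : ksgn k (m + n) = ksgn k m * ksgn k n := by
  simp [ksgn, Int.negOnePow_add]

theorem ksgn_mul_self (k : Type u) [Field k] (n : ℤ) : ksgn k n * ksgn k n = 1 := by
  rw [← ksgn_add, ksgn, Int.negOnePow_even _ ⟨n, rfl⟩]; simp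

/-- Transport along an equality of degrees. -/
def castLin (k : Type u) [Field k] (M : ℤ → Type w) [∀ n, AddCommGroup (M n)]
    [∀ n, Module k (M n)] {n m : ℤ} (h : n = m) : M n →ₗ[k] M m := by
  subst h; exact LinearMap.id

/-- A (non-symmetric) graded `C`-coloured operad over `k`. `obj c l n` is the homogeneous part of
degree `n` of the component with output colour `c` and list of input colours `l`.
`comp l₁ l₂ _ _ _ x y` is the partial composition of `y` into the input of `x` of colour `b`
that stands between the inputs `l₁` and `l₂`, i.e. `x ∘ᵢ y` with `i = l₁.length + 1`. The
equations between lists and degrees are arguments, so that no transport is needed. -/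
structure GradedOperad (k : Type u) [Field k] (C : Type v) where
  obj : C → List C → ℤ → Type w
  [acg : ∀ c l n, AddCommGroup (obj c l n)]
  [mod : ∀ c l n, Module k (obj c l n)]
  one : ∀ c, obj c [c] 0
  comp : ∀ {c b : C} {e m f : List C} {p q r : ℤ} (l₁ l₂ : List C)
    (_ : e = l₁ ++ b :: l₂) (_ : f = l₁ ++ (m ++ l₂)) (_ : r = p + q),
    obj c e p →ₗ[k] obj b m q →ₗ[k] obj c f r
  one_comp : ∀ {c : C} {l : List C} {n : ℤ} (he : [c] = [] ++ c :: []) (hf : l = [] ++ (l ++ []))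
    (hr : n = 0 + n) (x : obj c l n), comp [] [] he hf hr (one c) x = x
  comp_one : ∀ {c b : C} {e : List C} {n : ℤ} (l₁ l₂ : List C) (he : e = l₁ ++ b :: l₂)
    (hf : e = l₁ ++ ([b] ++ l₂)) (hr : n = n + 0) (x : obj c e n),
    comp l₁ l₂ he hf hr x (one b) = x
  /-- sequential associativity -/
  comp_assoc : ∀ {c b a : C} {e e' m m' n f : List C} {p q s r t u : ℤ} (l₁ l₂ m₁ m₂ : List C)
    (he : e = l₁ ++ b :: l₂) (hm : m = m₁ ++ a :: m₂)
    (hxy : e' = l₁ ++ (m ++ l₂)) (he' : e' = (l₁ ++ m₁) ++ a :: (m₂ ++ l₂))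
    (hyz : m' = m₁ ++ (n ++ m₂)) (hf : f = (l₁ ++ m₁) ++ (n ++ (m₂ ++ l₂)))
    (hf' : f = l₁ ++ (m' ++ l₂))
    (hr : r = p + q) (hu : u = r + s) (ht : t = q + s) (hu' : u = p + t)
    (x : obj c e p) (y : obj b m q) (z : obj a n s),
    comp (l₁ ++ m₁) (m₂ ++ l₂) he' hf hu (comp l₁ l₂ he hxy hr x y) z =
      comp l₁ l₂ he hf' hu' x (comp m₁ m₂ hm hyz ht y z)
  /-- parallel associativity, with the Koszul sign -/
  comp_comm : ∀ {c a b : C} {e e₁ e₂ m n f : List C} {p q s r t u : ℤ} (l₁ l₂ l₃ : List C)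
    (he : e = l₁ ++ a :: (l₂ ++ b :: l₃)) (he' : e = (l₁ ++ a :: l₂) ++ b :: l₃)
    (h₁ : e₁ = l₁ ++ (m ++ (l₂ ++ b :: l₃))) (h₁' : e₁ = (l₁ ++ (m ++ l₂)) ++ b :: l₃)
    (h₂ : e₂ = (l₁ ++ a :: l₂) ++ (n ++ l₃)) (h₂' : e₂ = l₁ ++ a :: (l₂ ++ (n ++ l₃)))
    (hf : f = (l₁ ++ (m ++ l₂)) ++ (n ++ l₃)) (hf' : f = l₁ ++ (m ++ (l₂ ++ (n ++ l₃))))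
    (hr : r = p + q) (hu : u = r + s) (ht : t = p + s) (hu' : u = t + q)
    (x : obj c e p) (y : obj a m q) (z : obj b n s),
    comp (l₁ ++ (m ++ l₂)) l₃ h₁' hf hu (comp l₁ (l₂ ++ b :: l₃) he h₁ hr x y) z =
      ksgn k (q * s) •
        comp l₁ (l₂ ++ (n ++ l₃)) h₂' hf' hu' (comp (l₁ ++ a :: l₂) l₃ he' h₂ ht x z) y

attribute [instance] GradedOperad.acg GradedOperad.mod

namespace GradedOperad

variable {k : Type u} [Field k] {C : Type v}

/-- Transport along an equality of degrees. -/
def castDeg (P : GradedOperad.{u, v, w} k C) {c : C} {l : List C} {n m : ℤ} (h : n = m) :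
    P.obj c l n →ₗ[k] P.obj c l m :=
  castLin k (P.obj c l) h

/-- Morphisms of graded coloured operads. -/
structure Hom (P : GradedOperad.{u, v, w} k C) (Q : GradedOperad.{u, v, x} k C) where
  map : ∀ {c : C} {l : List C} {n : ℤ}, P.obj c l n →ₗ[k] Q.obj c l n
  map_one : ∀ c, map (P.one c) = Q.one c
  map_comp : ∀ {c b : C} {e m f : List C} {p q r : ℤ} (l₁ l₂ : List C)
    (he : e = l₁ ++ b :: l₂) (hf : f = l₁ ++ (m ++ l₂)) (hr : r = p + q)
    (x : P.obj c e p) (y : P.obj b m q),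
    map (P.comp l₁ l₂ he hf hr x y) = Q.comp l₁ l₂ he hf hr (map x) (map y)

/-- The identity morphism. -/
def Hom.id (P : GradedOperad.{u, v, w} k C) : Hom P P where
  map := LinearMap.id
  map_one _ := rfl
  map_comp _ _ _ _ _ _ _ := rfl

/-- Composition of morphisms: first `f`, then `g`. -/
def Hom.trans {P Q T : GradedOperad k C} (f : Hom P Q) (g : Hom Q T) : Hom P T where
  map := g.map ∘ₗ f.map
  map_one c := by simp [f.map_one, g.map_one]
  map_comp l₁ l₂ he hf hr x y := by simp [f.map_comp, g.map_comp]

/-- Morphisms of graded collections `P → Q` that raise the degree by `d`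
(no compatibility with the operad structures). -/
abbrev CollHom (P : GradedOperad.{u, v, w} k C) (Q : GradedOperad.{u, v, x} k C) (d : ℤ) :=
  ∀ (c : C) (l : List C) (n : ℤ), P.obj c l n →ₗ[k] Q.obj c l (n + d)

/-- The operad `P ⊗ k[ε]/(ε²)` with `ε` of degree `-d`. The pair `(x₀, x₁)` stands for
`x₀ + ε x₁`; hence `x₁` has degree `n + d` if `x₀` has degree `n`. -/
def dual (P : GradedOperad.{u, v, w} k C) (d : ℤ) : GradedOperad.{u, v, w} k C where
  obj c l n := P.obj c l n × P.obj c l (n + d)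
  one c := (P.one c, 0)
  comp {c b e m f p q r} l₁ l₂ he hf hr := LinearMap.mk₂ k
    (fun x y => (P.comp l₁ l₂ he hf hr x.1 y.1,
      P.comp l₁ l₂ he hf (show r + d = (p + d) + q by omega) x.2 y.1 +
        ksgn k (d * p) • P.comp l₁ l₂ he hf (show r + d = p + (q + d) by omega) x.1 y.2))
    (by intro x x' y; ext <;> simp; module)
    (by intro a x y; ext <;> simp; module)
    (by intro x y y'; ext <;> simp; module)
    (by intro a x y; ext <;> simp; module)
  one_comp {c l n} he hf hr x := by
    ext
    · simp [P.one_comp]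
    · have := P.one_comp (n := n + d) he hf (by omega) x.2
      simp [ksgn_zero, this]
  comp_one l₁ l₂ he hf hr x := by
    ext
    · simp [P.comp_one]
    · simp [P.comp_one]
  comp_assoc {c b a e e' m m' n f p q s r t u} l₁ l₂ m₁ m₂ he hm hxy he' hyz hf hf' hr hu ht hu'
      x y z := by
    ext
    · exact P.comp_assoc l₁ l₂ m₁ m₂ he hm hxy he' hyz hf hf' hr hu ht hu' x.1 y.1 z.1
    · simp only [LinearMap.mk₂_apply, map_add, map_smul, LinearMap.add_apply,
        LinearMap.smul_apply, smul_add, smul_smul]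
      rw [P.comp_assoc l₁ l₂ m₁ m₂ he hm hxy he' hyz hf hf' _ _ ht (by omega),
        P.comp_assoc l₁ l₂ m₁ m₂ he hm hxy he' hyz hf hf' _ _
          (show t + d = q + d + s by omega) (by omega),
        P.comp_assoc l₁ l₂ m₁ m₂ he hm hxy he' hyz hf hf' _ _
          (show t + d = q + (s + d) by omega) (by omega)]
      subst hr
      rw [mul_add, ksgn_add, add_assoc]
  comp_comm {c a b e e₁ e₂ m n f p q s r t u} l₁ l₂ l₃ he he' h₁ h₁' h₂ h₂' hf hf' hr hu ht hu'
      x y z := by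
    ext
    · exact P.comp_comm l₁ l₂ l₃ he he' h₁ h₁' h₂ h₂' hf hf' hr hu ht hu' x.1 y.1 z.1
    · simp only [LinearMap.mk₂_apply, map_add, map_smul, LinearMap.add_apply,
        LinearMap.smul_apply, smul_add, smul_smul, Prod.smul_snd]
      rw [P.comp_comm l₁ l₂ l₃ he he' h₁ h₁' h₂ h₂' hf hf' _ _ (show t + d = p + d + s by omega)
          (by omega),
        P.comp_comm l₁ l₂ l₃ he he' h₁ h₁' h₂ h₂' hf hf' _ _ ht (by omega),
        P.comp_comm l₁ l₂ l₃ he he' h₁ h₁' h₂ h₂' hf hf' _ _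
          (show t + d = p + (s + d) by omega) (by omega)]
      subst hr ht
      simp only [smul_smul]
      have e1 : ksgn k (d * p) * ksgn k ((q + d) * s) =
          ksgn k (q * s) * ksgn k (d * (p + s)) := by
        rw [← ksgn_add, ← ksgn_add]; congr 1; ring
      have e2 : ksgn k (d * (p + q)) * ksgn k (q * (s + d)) =
          ksgn k (q * s) * ksgn k (d * p) := by
        rw [← ksgn_add, show d * (p + q) + q * (s + d) = q * s + d * p + (d * q + d * q) by ring,
          ksgn_add, ksgn_add _ (d * q), ksgn_mul_self, mul_one, ksgn_add]
      rw [e1, e2]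
      abel

/-- `∑ᵢ x ∘ᵢ u`, the sum being over the inputs of `x` in the final segment `l₂` of the list
`l = l₁ ++ l₂` of all inputs. -/
def sumCompFrom (P : GradedOperad.{u, v, w} k C) {d : ℤ} (u : ∀ c, P.obj c [c] d) {c : C}
    {l : List C} {n r : ℤ} (hr : r = n + d) (x : P.obj c l n) :
    ∀ (l₁ l₂ : List C), l = l₁ ++ l₂ → P.obj c l r
  | _, [], _ => 0
  | l₁, b :: l₂, h => P.comp l₁ l₂ h h hr x (u b) +
      sumCompFrom P u hr x (l₁ ++ [b]) l₂ (by simp [h])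

/-- `∑ᵢ x ∘ᵢ u`, the sum being over all inputs of `x`. -/
def sumComp (P : GradedOperad.{u, v, w} k C) {d : ℤ} (u : ∀ c, P.obj c [c] d) {c : C}
    {l : List C} {n r : ℤ} (hr : r = n + d) (x : P.obj c l n) : P.obj c l r :=
  P.sumCompFrom u hr x [] l rfl

/-- The composition of `x` with the degree zero elements `u` in each of the inputs in the final
segment `l₂` of the list `l = l₁ ++ l₂` of all inputs. -/
def compAllFrom (P : GradedOperad.{u, v, w} k C) (u : ∀ c, P.obj c [c] 0) {c : C}
    {l : List C} {n : ℤ} : ∀ (l₁ l₂ : List C), l = l₁ ++ l₂ → P.obj c l n → P.obj c l n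
  | _, [], _, x => x
  | l₁, b :: l₂, h, x => compAllFrom P u (l₁ ++ [b]) l₂ (by simp [h])
      (P.comp l₁ l₂ h h (add_zero n).symm x (u b))

/-- The full composition `x ∘ (u, …, u)`. -/
def compAll (P : GradedOperad.{u, v, w} k C) (u : ∀ c, P.obj c [c] 0) {c : C}
    {l : List C} {n : ℤ} (x : P.obj c l n) : P.obj c l n :=
  P.compAllFrom u [] l rfl x

end GradedOperad

/-! ## The endomorphism operad -/

section Endomorphism

variable (k : Type u) [Field k] {C : Type v} (A : C → ℤ → Type w)
  [∀ c n, AddCommGroup (A c n)] [∀ c n, Module k (A c n)]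

/-- The space of homogeneous multilinear maps of degree `n`, with inputs of colours `l` and output
of colour `c`, i.e. of degree `n` linear maps `A_{c₁} ⊗ ⋯ ⊗ A_{cₘ} → A_c`, in curried form. -/
def multiHom (c : C) : List C → ℤ → ModuleCat.{w} k
  | [], n => ModuleCat.of k (A c n)
  | b :: l, n => ModuleCat.of k (∀ p : ℤ, A b p →ₗ[k] multiHom c l (n + p))

variable {k A}

namespace multiHom

/-- Evaluation in the first argument. -/
def ap {c b : C} {l : List C} {n : ℤ} (f : multiHom k A c (b :: l) n) (p : ℤ) (a : A b p) :
    multiHom k A c l (n + p) := f p a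

theorem ext_cons {c b : C} {l : List C} {n : ℤ} {f g : multiHom k A c (b :: l) n}
    (h : ∀ (p : ℤ) (a : A b p), ap f p a = ap g p a) : f = g :=
  funext fun p => LinearMap.ext fun a => h p a

/-- Composition of `f` with `g` in the first input. -/
def compFirst {c b : C} {l₂ : List C} : ∀ (m : List C) {p q r : ℤ} (_ : r = p + q),
    multiHom k A c (b :: l₂) p →ₗ[k] multiHom k A b m q →ₗ[k] multiHom k A c (m ++ l₂) r
  | [], p, q, r, hr => LinearMap.mk₂ k
      (fun f g => (show multiHom k A c l₂ r from
        castLin k (fun i => multiHom k A c l₂ i) hr.symm (f q g)))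
      (by subst hr; intro f f' g; rfl)
      (by subst hr; intro a f g; rfl)
      (by subst hr; intro f g g'; exact map_add (f q) g g')
      (by subst hr; intro a f g; exact map_smul (f q) a g)
  | y :: m, p, q, r, hr => LinearMap.mk₂ k
      (fun f g => (show multiHom k A c (y :: (m ++ l₂)) r from
        fun s => (compFirst m (show r + s = p + (q + s) by omega) f) ∘ₗ (g s)))
      (by intro f f' g; refine ext_cons fun s a => ?_
          exact LinearMap.congr_fun (map_add (compFirst m _) f f') (g s a))
      (by intro x f g; refine ext_cons fun s a => ?_
          exact LinearMap.congr_fun (map_smul (compFirst m _) x f) (g s a))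
      (by intro f g g'; refine ext_cons fun s a => ?_
          exact map_add (compFirst m _ f) (g s a) (g' s a))
      (by intro x f g; refine ext_cons fun s a => ?_
          exact map_smul (compFirst m _ f) x (g s a))

/-- Composition of `f` with `g` in the input following the inputs `l₁`. Moving `g` past the
arguments that are plugged into `l₁` produces the Koszul sign. -/
def compAt {c b : C} {l₂ m : List C} {q : ℤ} : ∀ (l₁ : List C) {p r : ℤ} (_ : r = p + q),
    multiHom k A c (l₁ ++ b :: l₂) p →ₗ[k] multiHom k A b m q →ₗ[k]
      multiHom k A c (l₁ ++ (m ++ l₂)) r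
  | [], _, _, hr => compFirst m hr
  | y :: l₁, p, r, hr => LinearMap.mk₂ k
      (fun f g => (show multiHom k A c (y :: (l₁ ++ (m ++ l₂))) r from
        fun s => ksgn k (q * s) •
          ((compAt l₁ (show r + s = (p + s) + q by omega)).flip g ∘ₗ (f s))))
      (by intro f f' g; refine ext_cons fun s a => ?_
          exact (congrArg _ (map_add ((compAt l₁ _).flip g) (f s a) (f' s a))).trans
            (smul_add _ _ _))
      (by intro x f g; refine ext_cons fun s a => ?_
          exact (congrArg _ (map_smul ((compAt l₁ _).flip g) x (f s a))).trans
            (smul_comm _ _ _))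
      (by intro f g g'; refine ext_cons fun s a => ?_
          exact (congrArg _ (map_add (compAt l₁ _ (f s a)) g g')).trans
            (smul_add _ _ _))
      (by intro x f g; refine ext_cons fun s a => ?_
          exact (congrArg _ (map_smul (compAt l₁ _ (f s a)) x g)).trans
            (smul_comm _ _ _))

/-- The partial composition of multilinear maps. -/
def comp {c b : C} {e m f : List C} {p q r : ℤ} (l₁ l₂ : List C)
    (he : e = l₁ ++ b :: l₂) (hf : f = l₁ ++ (m ++ l₂)) (hr : r = p + q) :
    multiHom k A c e p →ₗ[k] multiHom k A b m q →ₗ[k] multiHom k A c f r := by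
  subst he hf; exact compAt l₁ hr

theorem comp_nil_cons {c b y : C} {l₂ m f : List C} {p q r : ℤ} (he : b :: l₂ = [] ++ b :: l₂)
    (hf : y :: f = [] ++ ((y :: m) ++ l₂)) (hr : r = p + q)
    (F : multiHom k A c (b :: l₂) p) (G : multiHom k A b (y :: m) q) (s : ℤ) (a : A y s) :
    ap (comp [] l₂ he hf hr F G) s a =
      comp [] l₂ he (List.cons.inj hf).2 (show r + s = p + (q + s) by omega) F (ap G s a) := by
  obtain rfl : f = m ++ l₂ := (List.cons.inj hf).2
  rfl

theorem comp_cons {c b y : C} {e m f : List C} {p q r : ℤ} (l₁ l₂ : List C)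
    (he : y :: e = (y :: l₁) ++ b :: l₂) (hf : y :: f = (y :: l₁) ++ (m ++ l₂)) (hr : r = p + q)
    (F : multiHom k A c (y :: e) p) (G : multiHom k A b m q) (s : ℤ) (a : A y s) :
    ap (comp (y :: l₁) l₂ he hf hr F G) s a =
      ksgn k (q * s) • comp l₁ l₂ (List.cons.inj he).2 (List.cons.inj hf).2
        (show r + s = (p + s) + q by omega) (ap F s a) G := by
  obtain rfl : e = l₁ ++ b :: l₂ := (List.cons.inj he).2
  obtain rfl : f = l₁ ++ (m ++ l₂) := (List.cons.inj hf).2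
  rfl

/-- The identity of `A_c`. -/
def one (c : C) : multiHom k A c [c] 0 :=
  (show ∀ p : ℤ, A c p →ₗ[k] A c (0 + p) from fun p => castLin k (A c) (zero_add p).symm)

theorem one_comp {c : C} {l : List C} {n : ℤ} (he : [c] = [] ++ c :: [])
    (hf : l = [] ++ (l ++ [])) (hr : n = 0 + n) (x : multiHom k A c l n) :
    comp [] [] he hf hr (one c) x = x := by
  induction l generalizing n with
  | nil =>
    have h : ∀ (r : ℤ) (h : 0 + n = r), castLin k (fun i => multiHom k A c [] i) h
        (castLin k (A c) (zero_add n).symm x) = castLin k (A c) ((zero_add n).symm.trans h) x := by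
      rintro _ rfl; rfl
    exact h n (zero_add n)
  | cons y l ih =>
    refine ext_cons fun s a => ?_
    rw [comp_nil_cons, ih]

theorem comp_one {c b : C} {e : List C} {n : ℤ} (l₁ l₂ : List C) (he : e = l₁ ++ b :: l₂)
    (hf : e = l₁ ++ ([b] ++ l₂)) (hr : n = n + 0) (x : multiHom k A c e n) :
    comp l₁ l₂ he hf hr x (one b) = x := by
  induction l₁ generalizing e n with
  | nil =>
    obtain rfl : e = b :: l₂ := he
    refine ext_cons fun s a => ?_
    refine (comp_nil_cons _ hf hr _ _ s a).trans ?_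
    have h : ∀ (t : ℤ) (h : s = t) (hr : n + s = n + t), comp [] l₂ (m := []) rfl rfl hr x
        (castLin k (A b) h a) = ap x s a := by
      rintro _ rfl _; rfl
    exact h _ _ _
  | cons y l₁ ih =>
    obtain rfl : e = y :: (l₁ ++ b :: l₂) := he
    refine ext_cons fun s a => ?_
    refine (comp_cons l₁ l₂ _ hf hr _ _ s a).trans ?_
    rw [zero_mul, ksgn_zero, one_smul]
    apply ih

theorem comp_assoc {c b a : C} {e e' m m' n f : List C} {p q s r t u : ℤ}
    (l₁ l₂ m₁ m₂ : List C)
    (he : e = l₁ ++ b :: l₂) (hm : m = m₁ ++ a :: m₂)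
    (hxy : e' = l₁ ++ (m ++ l₂)) (he' : e' = (l₁ ++ m₁) ++ a :: (m₂ ++ l₂))
    (hyz : m' = m₁ ++ (n ++ m₂)) (hf : f = (l₁ ++ m₁) ++ (n ++ (m₂ ++ l₂)))
    (hf' : f = l₁ ++ (m' ++ l₂))
    (hr : r = p + q) (hu : u = r + s) (ht : t = q + s) (hu' : u = p + t)
    (x : multiHom k A c e p) (y : multiHom k A b m q) (z : multiHom k A a n s) :
    comp (l₁ ++ m₁) (m₂ ++ l₂) he' hf hu (comp l₁ l₂ he hxy hr x y) z =
      comp l₁ l₂ he hf' hu' x (comp m₁ m₂ hm hyz ht y z) := by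
  induction l₁ generalizing e e' f p r u with
  | nil =>
    obtain rfl : e = b :: l₂ := he
    obtain rfl : e' = m ++ l₂ := hxy
    obtain rfl : f = m' ++ l₂ := hf'
    induction m₁ generalizing m m' q r t u with
    | nil =>
      obtain rfl : m = a :: m₂ := hm
      obtain rfl : m' = n ++ m₂ := hyz
      induction n generalizing s t u with
      | nil => subst hu ht; rfl
      | cons d n ih =>
        refine ext_cons fun v w => ?_
        refine (comp_nil_cons _ hf hu _ _ v w).trans ?_
        refine Eq.trans ?_ (comp_nil_cons _ _ hu' _ _ v w).symm
        refine Eq.trans ?_ (congrArg _ (comp_nil_cons rfl rfl ht y z v w).symm)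
        apply ih
    | cons d m₁ ih =>
      obtain rfl : m = d :: (m₁ ++ a :: m₂) := hm
      obtain rfl : m' = d :: (m₁ ++ (n ++ m₂)) := hyz
      refine ext_cons fun v w => ?_
      refine (comp_cons m₁ (m₂ ++ l₂) he' hf hu _ _ v w).trans ?_
      refine Eq.trans ?_ (comp_nil_cons _ _ hu' _ _ v w).symm
      refine Eq.trans ?_ (congrArg _ (comp_cons m₁ m₂ rfl rfl ht y z v w).symm)
      refine (congrArg (fun X => ksgn k (s * v) • comp m₁ (m₂ ++ l₂) _ _ _ X z)
        (comp_nil_cons rfl rfl hr x y v w)).trans ?_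
      rw [map_smul]
      refine congrArg _ ?_
      apply ih
  | cons d l₁ ih =>
    obtain rfl : e = d :: (l₁ ++ b :: l₂) := he
    obtain rfl : e' = d :: (l₁ ++ (m ++ l₂)) := hxy
    obtain rfl : f = d :: (l₁ ++ (m' ++ l₂)) := hf'
    refine ext_cons fun v w => ?_
    refine (comp_cons (l₁ ++ m₁) (m₂ ++ l₂) he' hf hu _ _ v w).trans ?_
    refine Eq.trans ?_ (comp_cons l₁ l₂ _ _ hu' _ _ v w).symm
    refine (congrArg (fun X => ksgn k (s * v) • comp (l₁ ++ m₁) (m₂ ++ l₂) _ _ _ X z)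
      (comp_cons l₁ l₂ rfl rfl hr x y v w)).trans ?_
    have hs : ksgn k (t * v) = ksgn k (s * v) * ksgn k (q * v) := by
      rw [ht, add_mul, add_comm (q * v), ksgn_add]
    rw [hs, map_smul, LinearMap.smul_apply, smul_smul]
    refine congrArg _ ?_
    apply ih

theorem comp_comm {c a b : C} {e e₁ e₂ m n f : List C} {p q s r t u : ℤ} (l₁ l₂ l₃ : List C)
    (he : e = l₁ ++ a :: (l₂ ++ b :: l₃)) (he' : e = (l₁ ++ a :: l₂) ++ b :: l₃)
    (h₁ : e₁ = l₁ ++ (m ++ (l₂ ++ b :: l₃))) (h₁' : e₁ = (l₁ ++ (m ++ l₂)) ++ b :: l₃)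
    (h₂ : e₂ = (l₁ ++ a :: l₂) ++ (n ++ l₃)) (h₂' : e₂ = l₁ ++ a :: (l₂ ++ (n ++ l₃)))
    (hf : f = (l₁ ++ (m ++ l₂)) ++ (n ++ l₃)) (hf' : f = l₁ ++ (m ++ (l₂ ++ (n ++ l₃))))
    (hr : r = p + q) (hu : u = r + s) (ht : t = p + s) (hu' : u = t + q)
    (x : multiHom k A c e p) (y : multiHom k A a m q) (z : multiHom k A b n s) :
    comp (l₁ ++ (m ++ l₂)) l₃ h₁' hf hu (comp l₁ (l₂ ++ b :: l₃) he h₁ hr x y) z =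
      ksgn k (q * s) •
        comp l₁ (l₂ ++ (n ++ l₃)) h₂' hf' hu' (comp (l₁ ++ a :: l₂) l₃ he' h₂ ht x z) y := by
  induction l₁ generalizing e e₁ e₂ f p r t u with
  | nil =>
    obtain rfl : e = a :: (l₂ ++ b :: l₃) := he
    obtain rfl : e₁ = m ++ (l₂ ++ b :: l₃) := h₁
    obtain rfl : e₂ = a :: (l₂ ++ (n ++ l₃)) := h₂'
    obtain rfl : f = m ++ (l₂ ++ (n ++ l₃)) := hf'
    induction m generalizing q r u with
    | nil =>
      subst hu' hr
      refine Eq.trans ?_ (congrArg (fun X => ksgn k (q * s) • X)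
        (comp_cons l₂ l₃ he' h₂ ht x z q y).symm)
      rw [smul_smul, mul_comm q s, ksgn_mul_self, one_smul]
      rfl
    | cons d m ih =>
      refine ext_cons fun v w => ?_
      refine (comp_cons (m ++ l₂) l₃ h₁' hf hu _ _ v w).trans ?_
      refine (congrArg (fun X => ksgn k (s * v) • comp (m ++ l₂) l₃ _ _ _ X z)
        (comp_nil_cons rfl rfl hr x y v w)).trans ?_
      refine Eq.trans ?_ (congrArg (fun X => ksgn k (q * s) • X) (comp_nil_cons rfl rfl hu'
        (comp ([] ++ a :: l₂) l₃ he' h₂ ht x z) y v w).symm)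
      have hs : ksgn k (q * s) = ksgn k (s * v) * ksgn k ((q + v) * s) := by
        rw [add_mul, ksgn_add, mul_comm v s, mul_left_comm, ksgn_mul_self, mul_one]
      rw [hs, ← smul_smul]
      refine congrArg _ ?_
      apply ih (ap y v w)
  | cons d l₁ ih =>
    obtain rfl : e = d :: (l₁ ++ a :: (l₂ ++ b :: l₃)) := he
    obtain rfl : e₁ = d :: (l₁ ++ (m ++ (l₂ ++ b :: l₃))) := h₁
    obtain rfl : e₂ = d :: (l₁ ++ a :: (l₂ ++ (n ++ l₃))) := h₂'
    obtain rfl : f = d :: (l₁ ++ (m ++ (l₂ ++ (n ++ l₃)))) := hf'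
    refine ext_cons fun v w => ?_
    refine (comp_cons (l₁ ++ (m ++ l₂)) l₃ h₁' hf hu _ _ v w).trans ?_
    refine (congrArg (fun X => ksgn k (s * v) • comp (l₁ ++ (m ++ l₂)) l₃ _ _ _ X z)
      (comp_cons l₁ (l₂ ++ b :: l₃) rfl rfl hr x y v w)).trans ?_
    refine Eq.trans ?_ (congrArg (fun X => ksgn k (q * s) • X)
      (comp_cons l₁ (l₂ ++ (n ++ l₃)) rfl rfl hu'
        (comp (d :: l₁ ++ a :: l₂) l₃ he' h₂ ht x z) y v w).symm)
    refine Eq.trans ?_ (congrArg (fun X => ksgn k (q * s) • ksgn k (q * v) •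
      comp l₁ (l₂ ++ (n ++ l₃)) _ _ _ X y)
      (comp_cons (l₁ ++ a :: l₂) l₃ he' h₂ ht x z v w).symm)
    rw [map_smul, LinearMap.smul_apply, map_smul, LinearMap.smul_apply, smul_smul, smul_smul,
      smul_smul, show ksgn k (q * s) * ksgn k (q * v) * ksgn k (s * v) =
        ksgn k (s * v) * ksgn k (q * v) * ksgn k (q * s) by ring, ← smul_smul _ (ksgn k (q * s))]
    refine congrArg _ ?_
    apply ih

end multiHom

variable (k A)

/-- The endomorphism operad of the graded colored vector space `A`. -/
def endOperad : GradedOperad.{u, v, w} k C where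
  obj c l n := multiHom k A c l n
  one := multiHom.one
  comp := multiHom.comp
  one_comp := multiHom.one_comp
  comp_one := multiHom.comp_one
  comp_assoc := multiHom.comp_assoc
  comp_comm := multiHom.comp_comm

end Endomorphism

/-! ## Free graded operads -/

section Free

variable {C : Type v}

/-- Formal operadic monomials in the set of generators `S`; `S c l n` is the set of generators
with output colour `c`, input colours `l` and degree `n`. -/
inductive OpMonomial (S : C → List C → ℤ → Type w) : C → List C → ℤ → Type (max v w)
  | gen {c : C} {l : List C} {n : ℤ} (g : S c l n) : OpMonomial S c l n
  | one (c : C) : OpMonomial S c [c] 0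
  | comp {c b : C} {e m f : List C} {p q r : ℤ} (l₁ l₂ : List C)
      (he : e = l₁ ++ b :: l₂) (hf : f = l₁ ++ (m ++ l₂)) (hr : r = p + q)
      (X : OpMonomial S c e p) (Y : OpMonomial S b m q) : OpMonomial S c f r

variable (k : Type u) [Field k] (S : C → List C → ℤ → Type w)

open OpMonomial in
/-- The relations between linear combinations of monomials that hold in every graded operad. -/
inductive OpRel : ∀ (c : C) (l : List C) (n : ℤ), (OpMonomial S c l n →₀ k) → Prop
  | one_comp {c : C} {l : List C} {n : ℤ} (he : [c] = [] ++ c :: []) (hf : l = [] ++ (l ++ []))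
      (hr : n = 0 + n) (X : OpMonomial S c l n) :
      OpRel c l n (Finsupp.single (comp [] [] he hf hr (one c) X) 1 - Finsupp.single X 1)
  | comp_one {c b : C} {e : List C} {n : ℤ} (l₁ l₂ : List C) (he : e = l₁ ++ b :: l₂)
      (hf : e = l₁ ++ ([b] ++ l₂)) (hr : n = n + 0) (X : OpMonomial S c e n) :
      OpRel c e n (Finsupp.single (comp l₁ l₂ he hf hr X (one b)) 1 - Finsupp.single X 1)
  | assoc {c b a : C} {e e' m m' n f : List C} {p q s r t u : ℤ} (l₁ l₂ m₁ m₂ : List C)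
      (he : e = l₁ ++ b :: l₂) (hm : m = m₁ ++ a :: m₂)
      (hxy : e' = l₁ ++ (m ++ l₂)) (he' : e' = (l₁ ++ m₁) ++ a :: (m₂ ++ l₂))
      (hyz : m' = m₁ ++ (n ++ m₂)) (hf : f = (l₁ ++ m₁) ++ (n ++ (m₂ ++ l₂)))
      (hf' : f = l₁ ++ (m' ++ l₂))
      (hr : r = p + q) (hu : u = r + s) (ht : t = q + s) (hu' : u = p + t)
      (X : OpMonomial S c e p) (Y : OpMonomial S b m q) (Z : OpMonomial S a n s) :
      OpRel c f u
        (Finsupp.single (comp (l₁ ++ m₁) (m₂ ++ l₂) he' hf hu (comp l₁ l₂ he hxy hr X Y) Z) 1 -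
          Finsupp.single (comp l₁ l₂ he hf' hu' X (comp m₁ m₂ hm hyz ht Y Z)) 1)
  | comm {c a b : C} {e e₁ e₂ m n f : List C} {p q s r t u : ℤ} (l₁ l₂ l₃ : List C)
      (he : e = l₁ ++ a :: (l₂ ++ b :: l₃)) (he' : e = (l₁ ++ a :: l₂) ++ b :: l₃)
      (h₁ : e₁ = l₁ ++ (m ++ (l₂ ++ b :: l₃))) (h₁' : e₁ = (l₁ ++ (m ++ l₂)) ++ b :: l₃)
      (h₂ : e₂ = (l₁ ++ a :: l₂) ++ (n ++ l₃)) (h₂' : e₂ = l₁ ++ a :: (l₂ ++ (n ++ l₃)))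
      (hf : f = (l₁ ++ (m ++ l₂)) ++ (n ++ l₃)) (hf' : f = l₁ ++ (m ++ (l₂ ++ (n ++ l₃))))
      (hr : r = p + q) (hu : u = r + s) (ht : t = p + s) (hu' : u = t + q)
      (X : OpMonomial S c e p) (Y : OpMonomial S a m q) (Z : OpMonomial S b n s) :
      OpRel c f u
        (Finsupp.single
            (comp (l₁ ++ (m ++ l₂)) l₃ h₁' hf hu (comp l₁ (l₂ ++ b :: l₃) he h₁ hr X Y) Z) 1 -
          ksgn k (q * s) • Finsupp.single (comp l₁ (l₂ ++ (n ++ l₃)) h₂' hf' hu'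
            (comp (l₁ ++ a :: l₂) l₃ he' h₂ ht X Z) Y) 1)
  | comp_left {c b : C} {e m f : List C} {p q r : ℤ} (l₁ l₂ : List C)
      (he : e = l₁ ++ b :: l₂) (hf : f = l₁ ++ (m ++ l₂)) (hr : r = p + q)
      (ξ : OpMonomial S c e p →₀ k) (Y : OpMonomial S b m q) (_ : OpRel c e p ξ) :
      OpRel c f r (Finsupp.lmapDomain k k (fun X => comp l₁ l₂ he hf hr X Y) ξ)
  | comp_right {c b : C} {e m f : List C} {p q r : ℤ} (l₁ l₂ : List C)
      (he : e = l₁ ++ b :: l₂) (hf : f = l₁ ++ (m ++ l₂)) (hr : r = p + q)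
      (X : OpMonomial S c e p) (η : OpMonomial S b m q →₀ k) (_ : OpRel b m q η) :
      OpRel c f r (Finsupp.lmapDomain k k (fun Y => comp l₁ l₂ he hf hr X Y) η)

/-- The span of the relations. -/
def opRelSpan (c : C) (l : List C) (n : ℤ) : Submodule k (OpMonomial S c l n →₀ k) :=
  Submodule.span k {ξ | OpRel k S c l n ξ}

namespace FreeOperad

/-- The components of the free operad. -/
abbrev Obj (c : C) (l : List C) (n : ℤ) : Type (max u v w) :=
  (OpMonomial S c l n →₀ k) ⧸ opRelSpan k S c l n

variable {S}

/-- The class of a monomial. -/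
def mono {c : C} {l : List C} {n : ℤ} (X : OpMonomial S c l n) : Obj k S c l n :=
  Submodule.Quotient.mk (Finsupp.single X 1)

theorem obj_hom_ext {c : C} {l : List C} {n : ℤ} {M : Type*} [AddCommGroup M] [Module k M]
    {φ ψ : Obj k S c l n →ₗ[k] M} (h : ∀ X, φ (mono k X) = ψ (mono k X)) : φ = ψ := by
  refine Submodule.linearMap_qext _ (Finsupp.lhom_ext' fun X => LinearMap.ext_ring ?_)
  exact h X

/-- Linear maps out of a component of the free operad. -/
def liftObj {c : C} {l : List C} {n : ℤ} {M : Type*} [AddCommGroup M] [Module k M]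
    (φ : OpMonomial S c l n → M)
    (h : ∀ ξ, OpRel k S c l n ξ → Finsupp.linearCombination k φ ξ = 0) :
    Obj k S c l n →ₗ[k] M :=
  (opRelSpan k S c l n).liftQ (Finsupp.linearCombination k φ) (by
    rw [opRelSpan, Submodule.span_le]
    intro ξ hξ
    exact h ξ hξ)

theorem liftObj_mono {c : C} {l : List C} {n : ℤ} {M : Type*} [AddCommGroup M] [Module k M]
    (φ : OpMonomial S c l n → M)
    (h : ∀ ξ, OpRel k S c l n ξ → Finsupp.linearCombination k φ ξ = 0) (X) :
    liftObj k φ h (mono k X) = φ X := by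
  simp [liftObj, mono]

theorem mk_eq {c : C} {l : List C} {n : ℤ} (ξ : OpMonomial S c l n →₀ k) :
    (Submodule.Quotient.mk ξ : Obj k S c l n) = Finsupp.linearCombination k (mono k) ξ := by
  have : (opRelSpan k S c l n).mkQ = Finsupp.linearCombination k (mono k) :=
    Finsupp.lhom_ext' fun X => LinearMap.ext_ring (by simp [mono])
  exact LinearMap.congr_fun this ξ

theorem lc_eq_zero {c : C} {l : List C} {n : ℤ} {ξ : OpMonomial S c l n →₀ k}
    (h : OpRel k S c l n ξ) : Finsupp.linearCombination k (mono k) ξ = 0 := by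
  rw [← mk_eq, Submodule.Quotient.mk_eq_zero]
  exact Submodule.subset_span h

/-- Partial composition in the free operad. -/
def comp {c b : C} {e m f : List C} {p q r : ℤ} (l₁ l₂ : List C)
    (he : e = l₁ ++ b :: l₂) (hf : f = l₁ ++ (m ++ l₂)) (hr : r = p + q) :
    Obj k S c e p →ₗ[k] Obj k S b m q →ₗ[k] Obj k S c f r :=
  liftObj k (fun X => liftObj k (fun Y => mono k (.comp l₁ l₂ he hf hr X Y)) (by
      intro η hη
      have := lc_eq_zero k (OpRel.comp_right l₁ l₂ he hf hr X η hη)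
      rwa [Finsupp.lmapDomain_apply, Finsupp.linearCombination_mapDomain] at this)) (by
    intro ξ hξ
    refine obj_hom_ext k fun Y => ?_
    have := lc_eq_zero k (OpRel.comp_left l₁ l₂ he hf hr ξ Y hξ)
    rw [Finsupp.lmapDomain_apply, Finsupp.linearCombination_mapDomain] at this
    refine Eq.trans ?_ this
    rw [Finsupp.linearCombination_apply, Finsupp.linearCombination_apply, Finsupp.sum, Finsupp.sum, LinearMap.sum_apply]
    refine Finset.sum_congr rfl fun X _ => ?_
    rw [LinearMap.smul_apply, liftObj_mono]
    rfl)

theorem comp_mono {c b : C} {e m f : List C} {p q r : ℤ} (l₁ l₂ : List C)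
    (he : e = l₁ ++ b :: l₂) (hf : f = l₁ ++ (m ++ l₂)) (hr : r = p + q)
    (X : OpMonomial S c e p) (Y : OpMonomial S b m q) :
    comp k l₁ l₂ he hf hr (mono k X) (mono k Y) = mono k (.comp l₁ l₂ he hf hr X Y) := by
  rw [comp, liftObj_mono, liftObj_mono]

end FreeOperad

open FreeOperad in
/-- The free graded operad on the graded collection `X` that has, in each colour and degree, the
basis `S`, i.e. on `X c l n = k⟨S c l n⟩`. -/
def freeOperad : GradedOperad.{u, v, max u v w} k C where
  obj c l n := Obj k S c l n
  one c := mono k (.one c)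
  comp := comp k
  one_comp {c l n} he hf hr x := by
    have : comp k [] [] he hf hr (mono k (S := S) (.one c)) = LinearMap.id := by
      refine obj_hom_ext k fun X => ?_
      have := lc_eq_zero k (OpRel.one_comp he hf hr X)
      rw [comp_mono]
      simpa [sub_eq_zero] using this
    exact LinearMap.congr_fun this x
  comp_one {c b e n} l₁ l₂ he hf hr x := by
    have : (comp k (c := c) l₁ l₂ he hf hr).flip (mono k (S := S) (.one b)) = LinearMap.id := by
      refine obj_hom_ext k fun X => ?_
      have := lc_eq_zero k (OpRel.comp_one l₁ l₂ he hf hr X)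
      rw [LinearMap.flip_apply, comp_mono]
      simpa [sub_eq_zero] using this
    exact LinearMap.congr_fun this x
  comp_assoc {c b a e e' m m' n f p q s r t u} l₁ l₂ m₁ m₂ he hm hxy he' hyz hf hf' hr hu ht hu'
      x y z := by
    induction x using Submodule.Quotient.induction_on with | _ ξ => ?_
    induction y using Submodule.Quotient.induction_on with | _ η => ?_
    induction z using Submodule.Quotient.induction_on with | _ ζ => ?_
    simp only [mk_eq]
    induction ξ using Finsupp.induction_linear with
    | zero => simp
    | add _ _ h h' => simp only [map_add, LinearMap.add_apply, h, h']
    | single X x => ?_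
    induction η using Finsupp.induction_linear with
    | zero => simp
    | add _ _ h h' => simp only [map_add, LinearMap.add_apply, h, h']
    | single Y y => ?_
    induction ζ using Finsupp.induction_linear with
    | zero => simp
    | add _ _ h h' => simp only [map_add, h, h']
    | single Z z => ?_
    have := lc_eq_zero k (OpRel.assoc l₁ l₂ m₁ m₂ he hm hxy he' hyz hf hf' hr hu ht hu' X Y Z)
    simp only [map_sub, Finsupp.linearCombination_single, one_smul, sub_eq_zero] at this
    simp only [Finsupp.linearCombination_single, map_smul, LinearMap.smul_apply, comp_mono, this]
  comp_comm {c a b e e₁ e₂ m n f p q s r t u} l₁ l₂ l₃ he he' h₁ h₁' h₂ h₂' hf hf' hr hu ht hu'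
      x y z := by
    induction x using Submodule.Quotient.induction_on with | _ ξ => ?_
    induction y using Submodule.Quotient.induction_on with | _ η => ?_
    induction z using Submodule.Quotient.induction_on with | _ ζ => ?_
    simp only [mk_eq]
    induction ξ using Finsupp.induction_linear with
    | zero => simp
    | add _ _ h h' => simp only [map_add, LinearMap.add_apply, h, h', smul_add]
    | single X x => ?_
    induction η using Finsupp.induction_linear with
    | zero => simp
    | add _ _ h h' => simp only [map_add, LinearMap.add_apply, h, h', smul_add]
    | single Y y => ?_
    induction ζ using Finsupp.induction_linear with
    | zero => simp
    | add _ _ h h' => simp only [map_add, LinearMap.add_apply, h, h', smul_add]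
    | single Z z => ?_
    have := lc_eq_zero k (OpRel.comm l₁ l₂ l₃ he he' h₁ h₁' h₂ h₂' hf hf' hr hu ht hu' X Y Z)
    simp only [map_sub, map_smul, Finsupp.linearCombination_single, one_smul, sub_eq_zero] at this
    simp only [Finsupp.linearCombination_single, map_smul, LinearMap.smul_apply, comp_mono, this,
      smul_smul]
    congr 1
    ring

namespace FreeOperad

variable {S}

/-- A generator, as an element of the free operad. -/
def gen {c : C} {l : List C} {n : ℤ} (g : S c l n) : (freeOperad k S).obj c l n :=
  mono k (.gen g)

variable {k}

/-- The value of a monomial in an operad, given the values of the generators. -/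
def eval (P : GradedOperad.{u, v, x} k C)
    (φ : ∀ (c : C) (l : List C) (n : ℤ), S c l n → P.obj c l n) :
    ∀ {c : C} {l : List C} {n : ℤ}, OpMonomial S c l n → P.obj c l n
  | _, _, _, .gen g => φ _ _ _ g
  | _, _, _, .one c => P.one c
  | _, _, _, .comp l₁ l₂ he hf hr X Y => P.comp l₁ l₂ he hf hr (eval P φ X) (eval P φ Y)

theorem eval_rel (P : GradedOperad.{u, v, x} k C)
    (φ : ∀ (c : C) (l : List C) (n : ℤ), S c l n → P.obj c l n)
    {c : C} {l : List C} {n : ℤ} {ξ : OpMonomial S c l n →₀ k} (h : OpRel k S c l n ξ) :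
    Finsupp.linearCombination k (fun X => eval P φ X) ξ = 0 := by
  induction h with
  | one_comp he hf hr X => simp [eval, P.one_comp]
  | comp_one l₁ l₂ he hf hr X => simp [eval, P.comp_one]
  | assoc l₁ l₂ m₁ m₂ he hm hxy he' hyz hf hf' hr hu ht hu' X Y Z =>
    simp [eval, P.comp_assoc l₁ l₂ m₁ m₂ he hm hxy he' hyz hf hf' hr hu ht hu']
  | comm l₁ l₂ l₃ he he' h₁ h₁' h₂ h₂' hf hf' hr hu ht hu' X Y Z =>
    simp [eval, P.comp_comm l₁ l₂ l₃ he he' h₁ h₁' h₂ h₂' hf hf' hr hu ht hu']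
  | comp_left l₁ l₂ he hf hr ξ Y _ ih =>
    rw [Finsupp.lmapDomain_apply, Finsupp.linearCombination_mapDomain]
    have := congrArg (fun v => P.comp l₁ l₂ he hf hr v (eval P φ Y)) ih
    simpa [Finsupp.linearCombination_apply, Finsupp.sum, eval, Function.comp_def] using this
  | comp_right l₁ l₂ he hf hr X η _ ih =>
    rw [Finsupp.lmapDomain_apply, Finsupp.linearCombination_mapDomain]
    have := congrArg (P.comp l₁ l₂ he hf hr (eval P φ X)) ih
    simpa [Finsupp.linearCombination_apply, Finsupp.sum, eval, Function.comp_def] using this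

/-- The morphism out of the free operad with given values on the generators. -/
def lift (P : GradedOperad.{u, v, x} k C)
    (φ : ∀ (c : C) (l : List C) (n : ℤ), S c l n → P.obj c l n) :
    GradedOperad.Hom (freeOperad k S) P where
  map := liftObj k (fun X => eval P φ X) fun _ h => eval_rel P φ h
  map_one c := liftObj_mono k _ _ _
  map_comp {c b e m f p q r} l₁ l₂ he hf hr x y := by
    have : (comp k l₁ l₂ he hf hr).compr₂ (liftObj k (fun X => eval P φ X)
          fun _ h => eval_rel P φ h) =
        (P.comp l₁ l₂ he hf hr).compl₁₂
          (liftObj k (fun X : OpMonomial S c e p => eval P φ X) fun _ h => eval_rel P φ h)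
          (liftObj k (fun X : OpMonomial S b m q => eval P φ X) fun _ h => eval_rel P φ h) := by
      refine obj_hom_ext k fun X => obj_hom_ext k fun Y => ?_
      simp only [LinearMap.compr₂_apply, LinearMap.compl₁₂_apply, comp_mono, liftObj_mono]
      rfl
    exact LinearMap.congr_fun₂ this x y

end FreeOperad

end Free

/-! ## Derivations -/

section Derivations

open GradedOperad

variable {k : Type u} [Field k] {C : Type v} {S : C → List C → ℤ → Type w}

/-- `θ`, of degree `d`, is a derivation along the morphism of operads `f : P → Q`. If `Q` is an
operad under `𝒜` and `f` is the composite of a morphism `P → 𝒜` with `𝒜 → Q`, these are the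
derivations `P → Q` of operads over `𝒜` with values in the `𝒜`-module `Q`. -/
def IsDer {P : GradedOperad.{u, v, w} k C} {Q : GradedOperad.{u, v, x} k C} (f : Hom P Q) {d : ℤ}
    (θ : CollHom P Q d) : Prop :=
  ∀ {c b : C} {e m g : List C} {p q r : ℤ} (l₁ l₂ : List C)
    (he : e = l₁ ++ b :: l₂) (hg : g = l₁ ++ (m ++ l₂)) (hr : r = p + q)
    (x : P.obj c e p) (y : P.obj b m q),
    θ c g r (P.comp l₁ l₂ he hg hr x y) =
      Q.comp l₁ l₂ he hg (show r + d = (p + d) + q by omega) (θ c e p x) (f.map y) +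
      ksgn k (d * p) •
        Q.comp l₁ l₂ he hg (show r + d = p + (q + d) by omega) (f.map x) (θ b m q y)

theorem FreeOperad.lift_gen (P : GradedOperad.{u, v, x} k C)
    (φ : ∀ (c : C) (l : List C) (n : ℤ), S c l n → P.obj c l n)
    {c : C} {l : List C} {n : ℤ} (g : S c l n) :
    (FreeOperad.lift P φ).map (FreeOperad.gen k g) = φ c l n g :=
  FreeOperad.liftObj_mono k _ (fun _ h => FreeOperad.eval_rel P φ h) _

theorem FreeOperad.map_mono {P : GradedOperad.{u, v, x} k C} (f : Hom (freeOperad k S) P)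
    {c : C} {l : List C} {n : ℤ} (X : OpMonomial S c l n) :
    f.map (FreeOperad.mono k X) =
      FreeOperad.eval P (fun _ _ _ g => f.map (FreeOperad.gen k g)) X := by
  induction X with
  | gen g => rfl
  | one c => exact f.map_one c
  | comp l₁ l₂ he hf hr X Y ihX ihY =>
    rw [← FreeOperad.comp_mono]
    exact (f.map_comp l₁ l₂ he hf hr _ _).trans (by rw [ihX, ihY]; rfl)

/-- The derivation of degree `d` along `f` out of a free operad with given values on the
generators: `f + ε · derExt f d φ` is the morphism to `P ⊗ k[ε]/(ε²)` with value
`f g + ε · φ g` on each generator `g`. -/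
def derExt {P : GradedOperad.{u, v, x} k C} (f : Hom (freeOperad k S) P) (d : ℤ)
    (φ : ∀ (c : C) (l : List C) (n : ℤ), S c l n → P.obj c l (n + d)) :
    CollHom (freeOperad k S) P d :=
  fun c l n => LinearMap.snd k (P.obj c l n) (P.obj c l (n + d)) ∘ₗ
    (FreeOperad.lift (P.dual d)
      fun c l n g => (f.map (FreeOperad.gen k g), φ c l n g)).map (c := c) (l := l) (n := n)

theorem derExt_gen {P : GradedOperad.{u, v, x} k C} (f : Hom (freeOperad k S) P) (d : ℤ)
    (φ : ∀ (c : C) (l : List C) (n : ℤ), S c l n → P.obj c l (n + d))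
    {c : C} {l : List C} {n : ℤ} (g : S c l n) :
    derExt f d φ c l n (FreeOperad.gen k g) = φ c l n g :=
  congrArg Prod.snd (FreeOperad.lift_gen (P.dual d) _ g)

theorem derExt_isDer {P : GradedOperad.{u, v, x} k C} (f : Hom (freeOperad k S) P) (d : ℤ)
    (φ : ∀ (c : C) (l : List C) (n : ℤ), S c l n → P.obj c l (n + d)) :
    IsDer f (derExt f d φ) := by
  set F := FreeOperad.lift (P.dual d) fun c l n (g : S c l n) =>
    (f.map (FreeOperad.gen k g), φ c l n g) with hF
  have key : ∀ {c : C} {l : List C} {n : ℤ} (y : (freeOperad k S).obj c l n),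
      (F.map y).1 = f.map y := by
    intro c l n y
    have : LinearMap.fst k (P.obj c l n) (P.obj c l (n + d)) ∘ₗ F.map = f.map := by
      refine FreeOperad.obj_hom_ext k fun X => ?_
      refine (congrArg Prod.fst (FreeOperad.map_mono F X)).trans
        (Eq.trans ?_ (FreeOperad.map_mono f X).symm)
      clear y
      induction X with
      | gen g =>
        exact congrArg Prod.fst (FreeOperad.lift_gen (P.dual d) _ g)
      | one c => rfl
      | comp l₁ l₂ he hf hr X Y ihX ihY =>
        exact congrArg₂ (fun a b => P.comp l₁ l₂ he hf hr a b) ihX ihY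
    exact LinearMap.congr_fun this y
  intro c b e m g p q r l₁ l₂ he hg hr x y
  have h := congrArg Prod.snd (F.map_comp l₁ l₂ he hg hr x y)
  have h' : derExt f d φ c g r ((freeOperad k S).comp l₁ l₂ he hg hr x y) =
      P.comp l₁ l₂ he hg (show r + d = (p + d) + q by omega) (F.map x).2 (F.map y).1 +
      ksgn k (d * p) •
        P.comp l₁ l₂ he hg (show r + d = p + (q + d) by omega) (F.map x).1 (F.map y).2 := h
  rw [h', key, key]
  rfl

/-- `Der^M`: the derivations of degree `d` along `f` out of a free operad that vanish on all the
generators in `M`. -/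
def derVanishing {Q : GradedOperad.{u, v, x} k C} (f : Hom (freeOperad k S) Q) (d : ℤ)
    (M : ∀ {c : C} {l : List C} {n : ℤ}, S c l n → Prop) :
    Submodule k (CollHom (freeOperad k S) Q d) where
  carrier := {θ | IsDer f θ ∧ ∀ {c : C} {l : List C} {n : ℤ} (g : S c l n),
    M g → θ c l n (FreeOperad.gen k g) = 0}
  zero_mem' := ⟨by intro; simp, by intros; rfl⟩
  add_mem' := by
    rintro θ θ' ⟨h, hM⟩ ⟨h', hM'⟩
    refine ⟨?_, fun g hg => ?_⟩
    · intro c b e m g p q r l₁ l₂ he hg hr x y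
      simp only [Pi.add_apply, LinearMap.add_apply, map_add, h l₁ l₂ he hg hr x y,
        h' l₁ l₂ he hg hr x y, smul_add]
      abel
    · simp [hM g hg, hM' g hg]
  smul_mem' := by
    rintro a θ ⟨h, hM⟩
    refine ⟨?_, fun g hg => ?_⟩
    · intro c b e m g p q r l₁ l₂ he hg hr x y
      simp only [Pi.smul_apply, LinearMap.smul_apply, map_smul, h l₁ l₂ he hg hr x y, smul_add,
        smul_comm a]
    · simp [hM g hg]

/-- `θ ↦ θ ∘ ∂` for a collection morphism `∂` of degree `-1`. If `∂` is the differential of `P` and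
the differential of `Q` is zero, this is the differential
`δ θ = θ ∂_P - (-1)^|θ| ∂_Q θ`. -/
def codiff {P : GradedOperad.{u, v, w} k C} (D : CollHom P P (-1)) (Q : GradedOperad.{u, v, x} k C)
    {d d' : ℤ} (h : d' = d - 1) : CollHom P Q d →ₗ[k] CollHom P Q d' where
  toFun θ := fun c l n => Q.castDeg (show n + -1 + d = n + d' by omega) ∘ₗ
    θ c l (n + -1) ∘ₗ D c l n
  map_add' θ θ' := by ext; simp
  map_smul' a θ := by ext; simp

end Derivations

/-! ## TJ-graded resolutions and the operad for algebras with derivation -/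

section Resolutions

open GradedOperad FreeOperad

variable {k : Type u} [Field k] {C : Type v}

/-- The additive extension to monomials of a grading `tj` of the generators. -/
def OpMonomial.tjDeg {S : C → List C → ℤ → Type w}
    (tj : ∀ {c : C} {l : List C} {n : ℤ}, S c l n → ℕ) :
    ∀ {c : C} {l : List C} {n : ℤ}, OpMonomial S c l n → ℕ
  | _, _, _, .gen g => tj g
  | _, _, _, .one _ => 0
  | _, _, _, .comp _ _ _ _ _ X Y => X.tjDeg tj + Y.tjDeg tj

/-- The part of degree `i` of the free operad, for the grading induced by a grading `tj` of the
generators. -/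
def tjPart (k : Type u) [Field k] {S : C → List C → ℤ → Type w}
    (tj : ∀ {c : C} {l : List C} {n : ℤ}, S c l n → ℕ) (i : ℤ) (c : C) (l : List C) (n : ℤ) :
    Submodule k ((freeOperad k S).obj c l n) :=
  Submodule.span k {x | ∃ X : OpMonomial S c l n, (X.tjDeg tj : ℤ) = i ∧ x = mono k X}

/-- A `TJ`-graded free resolution `ρ : (F(X), d) → (𝒜, 0)` of the graded operad `𝒜` (with zero
differential). The bigraded collection `X` is given by a bihomogeneous basis: the third argument
of `X` is the usual degree, and `tj` is the `TJ`-degree. -/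
structure TJResolution (𝒜 : GradedOperad.{u, v, w} k C) where
  X : C → List C → ℤ → Type x
  tj : ∀ {c : C} {l : List C} {n : ℤ}, X c l n → ℕ
  /-- the differential of `F(X)` -/
  d : CollHom (freeOperad k X) (freeOperad k X) (-1)
  d_isDer : IsDer (Hom.id _) d
  d_d : ∀ (c : C) (l : List C) (n : ℤ) (z : (freeOperad k X).obj c l n),
    d c l (n + -1) (d c l n z) = 0
  ρ : Hom (freeOperad k X) 𝒜
  ρ_d : ∀ (c : C) (l : List C) (n : ℤ) (z : (freeOperad k X).obj c l n), ρ.map (d c l n z) = 0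
  /-- `H_*(ρ)` is surjective -/
  quism_surj : ∀ (c : C) (l : List C) (n : ℤ) (a : 𝒜.obj c l n),
    ∃ z : (freeOperad k X).obj c l n, d c l n z = 0 ∧ ρ.map z = a
  /-- `H_*(ρ)` is injective -/
  quism_inj : ∀ (c : C) (l : List C) (n : ℤ) (z : (freeOperad k X).obj c l n),
    d c l n z = 0 → ρ.map z = 0 → ∃ y : (freeOperad k X).obj c l (n + 1),
      (freeOperad k X).castDeg (add_neg_cancel_right n 1) (d c l (n + 1) y) = z
  /-- `d` lowers the `TJ`-degree by one (in particular, it maps a generator of `TJ`-degree `i` to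
  the suboperad generated by the generators of `TJ`-degree less than `i`) -/
  d_tj : ∀ {c : C} {l : List C} {n : ℤ} (g : X c l n),
    d c l n (gen k g) ∈ tjPart k tj ((tj g : ℤ) - 1) c l (n + -1)
  /-- `ρ` preserves the `TJ`-degree, `𝒜` being concentrated in `TJ`-degree `0` -/
  ρ_tj : ∀ {c : C} {l : List C} {n : ℤ} (g : X c l n), tj g ≠ 0 → ρ.map (gen k g) = 0
  /-- `H_0(ρ)`, for the `TJ`-grading, is surjective -/
  h0_surj : ∀ (c : C) (l : List C) (n : ℤ) (a : 𝒜.obj c l n),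
    ∃ z ∈ tjPart k tj 0 c l n, ρ.map z = a
  /-- `H_0(ρ)`, for the `TJ`-grading, is injective -/
  h0_inj : ∀ (c : C) (l : List C) (n : ℤ), ∀ z ∈ tjPart k tj 0 c l n, ρ.map z = 0 →
    ∃ y ∈ tjPart k tj 1 c l (n + 1),
      (freeOperad k X).castDeg (add_neg_cancel_right n 1) (d c l (n + 1) y) = z

/-- The basis of the collection `X ⊕ Φ ⊕ ↑X`: the elements `x` of the basis of `X`, the elements
`phi c` of arity `1` and degree `0`, and the suspensions `ux` of the elements of the basis of
`X`. -/
inductive DRGen (X : C → List C → ℤ → Type w) : C → List C → ℤ → Type (max v w)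
  | x {c : C} {l : List C} {n : ℤ} (g : X c l n) : DRGen X c l n
  | phi (c : C) : DRGen X c [c] 0
  | ux {c : C} {l : List C} {n : ℤ} (g : X c l n) : DRGen X c l (n + 1)

namespace DRGen

variable {X : C → List C → ℤ → Type w}

/-- The generators from `X`. -/
def IsX {c : C} {l : List C} {n : ℤ} : DRGen X c l n → Prop
  | .x _ => True
  | .phi _ => False
  | .ux _ => False

/-- The generators from `↑X`. -/
def IsUX {c : C} {l : List C} {n : ℤ} : DRGen X c l n → Prop
  | .x _ => False
  | .phi _ => False
  | .ux _ => True

/-- The `TJ`-degree: that of `x` for `x ∈ X`, zero for `phi`, and the suspension raises it by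
one. -/
def tjDeg (tj : ∀ {c : C} {l : List C} {n : ℤ}, X c l n → ℕ) {c : C} {l : List C} {n : ℤ} :
    DRGen X c l n → ℕ
  | .x g => tj g
  | .phi _ => 0
  | .ux g => tj g + 1

end DRGen

namespace TJResolution

variable {𝒜 : GradedOperad.{u, v, w} k C} (R : TJResolution.{u, v, w, x} 𝒜)

/-- The underlying free operad `F(X)` of the resolution. -/
abbrev operad : GradedOperad.{u, v, max u v x} k C := freeOperad k R.X

/-- The underlying graded operad `F(X ⊕ Φ ⊕ ↑X)` of the resolution of the operad for
`𝒜`-algebras with derivation. -/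
abbrev DR : GradedOperad.{u, v, max u v x} k C := freeOperad k (DRGen R.X)

/-- The inclusion of `F(X)`. -/
def incl : Hom R.operad R.DR :=
  lift R.DR fun _ _ _ g => gen k (DRGen.x g)

/-- The derivation `s : F(X) → F(X ⊕ Φ ⊕ ↑X)` of degree `1` with `s x = ↑x`. -/
def s : CollHom R.operad R.DR 1 :=
  derExt R.incl 1 fun _ _ _ g => gen k (DRGen.ux g)

/-- The differential of `F(X ⊕ Φ ⊕ ↑X)` on the generators:
`x ↦ d x`, `φ ↦ 0`, `↑x ↦ φ ∘₁ x - ∑ᵢ x ∘ᵢ φ - s (d x)`. -/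
def dDRGen : ∀ (c : C) (l : List C) (n : ℤ), DRGen R.X c l n → R.DR.obj c l (n + -1)
  | c, l, n, .x g => R.incl.map (R.d c l n (gen k g))
  | _, _, _, .phi _ => 0
  | c, l, _, .ux (n := n) g =>
      R.DR.comp [] [] (show [c] = [] ++ c :: [] from rfl) (by simp)
        (show n + 1 + -1 = 0 + n by omega) (gen k (DRGen.phi c)) (gen k (DRGen.x g)) -
      R.DR.sumComp (fun b => gen k (DRGen.phi b)) (show n + 1 + -1 = n + 0 by omega)
        (gen k (DRGen.x g)) -
      R.DR.castDeg (show n + -1 + 1 = n + 1 + -1 by omega) (R.s c l (n + -1) (R.d c l n (gen k g)))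

/-- The differential of `F(X ⊕ Φ ⊕ ↑X)`, a derivation. -/
def dDR : CollHom R.DR R.DR (-1) :=
  derExt (Hom.id R.DR) (-1) R.dDRGen

/-- The morphism `F(X ⊕ Φ ⊕ ↑X) → 𝒜` that equals `ρ` on `X` and vanishes on the other
generators. -/
def ρDR : Hom R.DR 𝒜 :=
  lift 𝒜 fun
    | _, _, _, .x g => R.ρ.map (gen k g)
    | _, _, _, .phi _ => 0
    | _, _, _, .ux _ => 0

end TJResolution

/-! ## The cotangent complexes -/

/-- The cohomology `ker(C₁ → M₂) / im(C₀ → M₁)` for submodules `C₀ ⊆ M₀`, `C₁ ⊆ M₁` with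
`δ₀ C₀ ⊆ C₁`, `δ₁ δ₀ C₀ = 0`. -/
abbrev cohomologyAt {M₀ M₁ M₂ : Type*} [AddCommGroup M₀] [Module k M₀] [AddCommGroup M₁]
    [Module k M₁] [AddCommGroup M₂] [Module k M₂] (δ₀ : M₀ →ₗ[k] M₁) (δ₁ : M₁ →ₗ[k] M₂)
    (C₀ : Submodule k M₀) (C₁ : Submodule k M₁) : Type _ :=
  ↥(C₁ ⊓ LinearMap.ker δ₁) ⧸ (C₀.map δ₀).submoduleOf (C₁ ⊓ LinearMap.ker δ₁)

namespace TJResolution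

variable {𝒜 : GradedOperad.{u, v, w} k C} (R : TJResolution.{u, v, w, x} 𝒜)
  {E : GradedOperad.{u, v, y} k C} (alg : Hom 𝒜 E)

/-- The operadic cotangent complex in `TJ`-degree `n`, internal degree `w`: derivations
`F(X) → E` over `𝒜` that vanish on all generators of `TJ`-degree other than `n - 1` (the shift by
one is the suspension in the definition of the complex). Their usual degree is `w - (n - 1)`. -/
def cochains (w n : ℤ) : Submodule k (CollHom R.operad E (w - (n - 1))) :=
  derVanishing (R.ρ.trans alg) (w - (n - 1)) fun g => (R.tj g : ℤ) ≠ n - 1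

/-- The augmented operadic cotangent complex in `TJ`-degree `n`, internal degree `w`: derivations
`F(X ⊕ Φ ⊕ ↑X) → E` over `𝒜` that vanish on `X` and on all generators of `TJ`-degree other
than `n`. Their usual degree is `w - n`. -/
def augCochains (w n : ℤ) : Submodule k (CollHom R.DR E (w - n)) :=
  derVanishing (R.ρDR.trans alg) (w - n) fun g => g.IsX ∨ (g.tjDeg R.tj : ℤ) ≠ n

/-- The differential of the cotangent complex. -/
def δ (E : GradedOperad.{u, v, y} k C) (w : ℤ) {n n' : ℤ} (h : n' = n + 1) :
    CollHom R.operad E (w - (n - 1)) →ₗ[k] CollHom R.operad E (w - (n' - 1)) :=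
  codiff R.d E (by omega)

/-- The differential of the augmented cotangent complex. -/
def augδ (E : GradedOperad.{u, v, y} k C) (w : ℤ) {n n' : ℤ} (h : n' = n + 1) :
    CollHom R.DR E (w - n) →ₗ[k] CollHom R.DR E (w - n') :=
  codiff R.dDR E (by omega)

/-- The cocycles of the cotangent complex. -/
abbrev cocycles (w n : ℤ) : Submodule k (CollHom R.operad E (w - (n - 1))) :=
  R.cochains alg w n ⊓ LinearMap.ker (R.δ E w (rfl : n + 1 = n + 1))

/-- The cocycles of the augmented cotangent complex. -/
abbrev augCocycles (w n : ℤ) : Submodule k (CollHom R.DR E (w - n)) :=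
  R.augCochains alg w n ⊓ LinearMap.ker (R.augδ E w (rfl : n + 1 = n + 1))

/-- Operadic cohomology in `TJ`-degree `n` and internal degree `w`. -/
abbrev cohomology (w n : ℤ) : Type _ :=
  cohomologyAt (R.δ E w (sub_add_cancel n 1).symm) (R.δ E w (rfl : n + 1 = n + 1))
    (R.cochains alg w (n - 1)) (R.cochains alg w n)

/-- Augmented operadic cohomology in `TJ`-degree `n` and internal degree `w`. -/
abbrev augCohomology (w n : ℤ) : Type _ :=
  cohomologyAt (R.augδ E w (sub_add_cancel n 1).symm) (R.augδ E w (rfl : n + 1 = n + 1))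
    (R.augCochains alg w (n - 1)) (R.augCochains alg w n)

end TJResolution

/-! ## Formal infinitesimal deformations -/

section Deformations

variable {𝒜 : GradedOperad.{u, v, w} k C} {E : GradedOperad.{u, v, y} k C} (alg : Hom 𝒜 E)

/-- `D` is a formal infinitesimal deformation of `alg`, with a parameter `ε` of degree `-w`:
`a ↦ alg a + ε D a` is a morphism of operads `𝒜 → E ⊗ k[ε]/(ε²)`. -/
def IsDeformation {w : ℤ} (D : CollHom 𝒜 E w) : Prop :=
  ∃ F : Hom 𝒜 (E.dual w), ∀ (c : C) (l : List C) (n : ℤ) (a : 𝒜.obj c l n),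
    F.map a = (alg.map a, D c l n a)

theorem isDeformation_iff {w : ℤ} (D : CollHom 𝒜 E w) :
    IsDeformation alg D ↔ (∀ c, D c [c] 0 (𝒜.one c) = 0) ∧ IsDer alg D := by
  constructor
  · rintro ⟨F, hF⟩
    refine ⟨fun c => ?_, ?_⟩
    · exact congrArg Prod.snd ((hF c [c] 0 (𝒜.one c)).symm.trans (F.map_one c))
    · intro c b e m g p q r l₁ l₂ he hg hr x y
      have h := F.map_comp l₁ l₂ he hg hr x y
      rw [hF, hF, hF] at h
      exact congrArg Prod.snd h
  · rintro ⟨h1, h2⟩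
    refine ⟨⟨fun {c l n} => alg.map.prod (D c l n), fun c => ?_, ?_⟩, fun _ _ _ _ => rfl⟩
    · exact Prod.ext (alg.map_one c) (h1 c)
    · intro c b e m g p q r l₁ l₂ he hg hr x y
      exact Prod.ext (alg.map_comp l₁ l₂ he hg hr x y) (h2 l₁ l₂ he hg hr x y)

/-- The `k`-module of formal infinitesimal deformations of `alg`, with a parameter `ε` of degree
`-w`. -/
def deformations (w : ℤ) : Submodule k (CollHom 𝒜 E w) where
  carrier := {D | IsDeformation alg D}
  zero_mem' := by
    rw [Set.mem_ofPred_eq, isDeformation_iff]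
    exact ⟨fun _ => rfl, by intro; simp⟩
  add_mem' := by
    intro D D' h h'
    rw [Set.mem_ofPred_eq, isDeformation_iff] at h h' ⊢
    refine ⟨fun c => by simp [h.1, h'.1], ?_⟩
    intro c b e m g p q r l₁ l₂ he hg hr x y
    simp only [Pi.add_apply, LinearMap.add_apply, map_add, h.2 l₁ l₂ he hg hr x y,
      h'.2 l₁ l₂ he hg hr x y, smul_add]
    abel
  smul_mem' := by
    intro a D h
    rw [Set.mem_ofPred_eq, isDeformation_iff] at h ⊢
    refine ⟨fun c => by simp [h.1], ?_⟩
    intro c b e m g p q r l₁ l₂ he hg hr x y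
    simp only [Pi.smul_apply, LinearMap.smul_apply, map_smul, h.2 l₁ l₂ he hg hr x y, smul_add,
      smul_comm a]

/-- Two formal infinitesimal deformations are related by an infinitesimal automorphism `1 + ε h`:
`(1 + ε h) ∘ (alg + ε D)(a) = (alg + ε D')(a) ∘ (1 + ε h, …, 1 + ε h)` for all `a`. -/
def DefEquiv {w : ℤ} (D D' : CollHom 𝒜 E w) : Prop :=
  ∃ h : ∀ c, E.obj c [c] (0 + w), ∀ (c : C) (l : List C) (n : ℤ) (a : 𝒜.obj c l n),
    (E.dual w).comp [] [] (show [c] = [] ++ c :: [] from rfl) (by simp)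
        (show n = 0 + n by omega) (E.one c, h c) (alg.map a, D c l n a) =
      (E.dual w).compAll (fun b => (E.one b, h b)) (alg.map a, D' c l n a)

/-- The submodule generated by the differences of formal infinitesimal deformations that are
related by an infinitesimal automorphism. -/
def defEquivSpan (w : ℤ) : Submodule k (deformations alg w) :=
  Submodule.span k {B | ∃ D D' : deformations alg w, DefEquiv alg D.1 D'.1 ∧ B = D - D'}

end Deformations

end Resolutions

end

-- A derivation over `𝒜` out of a free operad amounts to an arbitrary choice of values on the
-- generators (`derExt`, `IsDer.ext_gen`). An augmented cochain `θ` vanishes on `X`. Its data are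
-- therefore its values on `Φ`, which occur only in TJ-degree 0, and its values on `↑X`, which are
-- recorded by the composite `θ ∘ s`, a derivation out of `F(X)`.
--
-- Everything rests on one identity, `comp_s_comp_dDR`: `(δθ) ∘ s = [θ(φ), -] - δ(θ ∘ s)`, where
-- `[U, -]` is the inner derivation `a ↦ U ∘ a - (±) ∑ᵢ a ∘ᵢ U` taken along `α ∘ ρ`. Both sides are
-- derivations, so it suffices to compare them on a generator `x`, where the identity is the formula
-- for the differential of `↑x`. That inner derivations are derivations is the signed computation
-- `inner_isDer`. That the composites are derivations follows from `IsDer.compColl`, because the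
-- morphism to `𝒜` kills the images of `s` and of the differential (`ρDR_s`, `ρDR_dDR`).
--
-- In degree `n ≠ 0` the bracket vanishes, and `θ ↦ θ ∘ s` is a bijection of cochains that
-- anticommutes with `δ`. For `n ≥ 2` this also covers degree `n - 1`, so cocycles and coboundaries
-- both match. The same identity gives `δ² = 0` on the augmented complex without squaring the
-- differential of `F(X ⊕ Φ ⊕ ↑X)`: inner derivations factor through `ρ`, which kills boundaries.
--
-- In degree 1 the cocycles still match, but the coboundaries now come from `Φ`. The cotangent
-- complex is zero in degree 0, so the coboundaries are exactly the inner derivations. A 1-cocycle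
-- of the cotangent complex vanishes on the generators of positive TJ-degree and on all boundaries.
-- Since `H₀` of the resolution is `𝒜`, it vanishes on the kernel of `ρ` (`eq_zero_of_ρ_eq_zero`)
-- and descends to a derivation `D` of `𝒜`, that is, to a deformation `α + εD`
-- (`deformationsEquiv`). Comparing coefficients of `ε` shows that `1 + εh` relates `D` to `D'`
-- exactly when `D' - D = [h, -]` (`defEquiv_iff`).

universe z

/-! ### Degree identities used in transports -/

section Degrees

theorem degree_zero_eq (w : ℤ) : 0 + (w - 0) = w := by omega

theorem degree_one_eq (n w : ℤ) : n + 1 + (w - 1) = n + w := by omega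

theorem degree_shift_eq (m w n : ℤ) : m + 1 + (w - n) = m + (w - (n - 1)) := by omega

end Degrees

/-! ### Transport of degrees and of input lists in an operad -/

section OperadLemmas

namespace GradedOperad

variable {k : Type u} [Field k] {C : Type v}

theorem castDeg_castDeg (P : GradedOperad.{u, v, w} k C) {c : C} {l : List C} {n m r : ℤ}
    (h : n = m) (h' : m = r) (x : P.obj c l n) :
    P.castDeg h' (P.castDeg h x) = P.castDeg (h.trans h') x := by
  subst h h'; rfl

theorem castDeg_eq_iff (P : GradedOperad.{u, v, w} k C) {c : C} {l : List C} {n m : ℤ}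
    (h : n = m) (x : P.obj c l n) (z : P.obj c l m) :
    P.castDeg h x = z ↔ x = P.castDeg h.symm z := by
  subst h; rfl

theorem castDeg_eq_zero (P : GradedOperad.{u, v, w} k C) {c : C} {l : List C} {n m : ℤ}
    (h : n = m) (x : P.obj c l n) : P.castDeg h x = 0 ↔ x = 0 := by
  subst h; rfl

theorem castDeg_comp (P : GradedOperad.{u, v, w} k C) {c b : C} {e m f : List C} {p q r r' : ℤ}
    (l₁ l₂ : List C) (he : e = l₁ ++ b :: l₂) (hf : f = l₁ ++ (m ++ l₂)) (hr : r = p + q)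
    (h : r = r') (x : P.obj c e p) (z : P.obj b m q) :
    P.castDeg h (P.comp l₁ l₂ he hf hr x z) = P.comp l₁ l₂ he hf (h.symm.trans hr) x z := by
  subst h; rfl

theorem comp_castDeg_left (P : GradedOperad.{u, v, w} k C) {c b : C} {e m f : List C}
    {p p' q r : ℤ} (l₁ l₂ : List C) (he : e = l₁ ++ b :: l₂) (hf : f = l₁ ++ (m ++ l₂))
    (h : p = p') (hr : r = p' + q) (x : P.obj c e p) (z : P.obj b m q) :
    P.comp l₁ l₂ he hf hr (P.castDeg h x) z = P.comp l₁ l₂ he hf (by rw [hr, h]) x z := by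
  subst h; rfl

theorem comp_castDeg_right (P : GradedOperad.{u, v, w} k C) {c b : C} {e m f : List C}
    {p q q' r : ℤ} (l₁ l₂ : List C) (he : e = l₁ ++ b :: l₂) (hf : f = l₁ ++ (m ++ l₂))
    (h : q = q') (hr : r = p + q') (x : P.obj c e p) (z : P.obj b m q) :
    P.comp l₁ l₂ he hf hr x (P.castDeg h z) = P.comp l₁ l₂ he hf (by rw [hr, h]) x z := by
  subst h; rfl

/-- An input is encoded by the lists on its two sides. The associativity axioms produce lists such
as `l₁ ++ []` or `l₁ ++ b :: l₂' ++ [a]`, which agree with the required ones only propositionally.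
-/
theorem comp_congr_lists (P : GradedOperad.{u, v, w} k C) {c b : C} {e m f : List C}
    {p q r : ℤ} {l₁ l₂ l₁' l₂' : List C} (h₁ : l₁ = l₁') (h₂ : l₂ = l₂')
    (he : e = l₁ ++ b :: l₂) (hf : f = l₁ ++ (m ++ l₂))
    (hr : r = p + q) (x : P.obj c e p) (z : P.obj b m q) :
    P.comp l₁ l₂ he hf hr x z =
      P.comp l₁' l₂' (by rw [he, h₁, h₂]) (by rw [hf, h₁, h₂]) hr x z := by
  subst h₁ h₂; rfl

theorem one_comp_cast (P : GradedOperad.{u, v, w} k C) {c : C} {l : List C} {n r : ℤ}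
    (he : [c] = [] ++ c :: []) (hf : l = [] ++ (l ++ [])) (hr : r = 0 + n) (x : P.obj c l n) :
    P.comp [] [] he hf hr (P.one c) x = P.castDeg (hr.trans (zero_add n)).symm x := by
  obtain rfl : r = n := hr.trans (zero_add n)
  exact P.one_comp he hf hr x

theorem comp_one_cast (P : GradedOperad.{u, v, w} k C) {c b : C} {e : List C} {n r : ℤ}
    (l₁ l₂ : List C) (he : e = l₁ ++ b :: l₂) (hf : e = l₁ ++ ([b] ++ l₂)) (hr : r = n + 0)
    (x : P.obj c e n) :
    P.comp l₁ l₂ he hf hr x (P.one b) = P.castDeg (hr.trans (add_zero n)).symm x := by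
  obtain rfl : r = n := hr.trans (add_zero n)
  exact P.comp_one l₁ l₂ he hf hr x

theorem Hom.map_castDeg {P : GradedOperad.{u, v, w} k C} {Q : GradedOperad.{u, v, x} k C}
    (f : Hom P Q) {c : C} {l : List C} {n m : ℤ} (h : n = m) (x : P.obj c l n) :
    f.map (P.castDeg h x) = Q.castDeg h (f.map x) := by
  subst h; rfl

theorem collHom_castDeg {P : GradedOperad.{u, v, w} k C} {Q : GradedOperad.{u, v, x} k C} {d : ℤ}
    (θ : CollHom P Q d) {c : C} {l : List C} {n m : ℤ} (h : n = m) (x : P.obj c l n) :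
    θ c l m (P.castDeg h x) = Q.castDeg (by rw [h]) (θ c l n x) := by
  subst h; rfl

/-! ### Insertion of unary operations into a partial composition -/

section SumComp

variable (P : GradedOperad.{u, v, w} k C) {d : ℤ} (U : ∀ c, P.obj c [c] d)

theorem sumCompFrom_congr_lists {c : C} {l : List C} {n r : ℤ} (hr : r = n + d)
    (x : P.obj c l n) {l₁ l₂ l₁' l₂' : List C} (h₁ : l₁ = l₁') (h₂ : l₂ = l₂')
    (h : l = l₁ ++ l₂) :
    P.sumCompFrom U hr x l₁ l₂ h = P.sumCompFrom U hr x l₁' l₂' (by rw [h, h₁, h₂]) := by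
  subst h₁ h₂; rfl

theorem sumCompFrom_nil {c : C} {l : List C} {n r : ℤ} (hr : r = n + d) (x : P.obj c l n)
    (l₁ : List C) (h : l = l₁ ++ []) : P.sumCompFrom U hr x l₁ [] h = 0 := rfl

theorem sumCompFrom_cons {c b : C} {l : List C} {n r : ℤ} (hr : r = n + d) (x : P.obj c l n)
    (l₁ l₂ : List C) (h : l = l₁ ++ b :: l₂) :
    P.sumCompFrom U hr x l₁ (b :: l₂) h = P.comp l₁ l₂ h h hr x (U b) +
      P.sumCompFrom U hr x (l₁ ++ [b]) l₂ (by simp [h]) := rfl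

theorem castDeg_sumCompFrom {c : C} {l : List C} {n r r' : ℤ} (hr : r = n + d) (h : r = r')
    (x : P.obj c l n) (l₁ l₂ : List C) (hl : l = l₁ ++ l₂) :
    P.castDeg h (P.sumCompFrom U hr x l₁ l₂ hl) =
      P.sumCompFrom U (h.symm.trans hr) x l₁ l₂ hl := by
  subst h; rfl

/-- `sumCompFrom` is linear in the element into which one composes. -/
def sumCompFromLin {c : C} {l : List C} {n r : ℤ} (hr : r = n + d) :
    ∀ (l₁ l₂ : List C), l = l₁ ++ l₂ → (P.obj c l n →ₗ[k] P.obj c l r)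
  | _, [], _ => 0
  | l₁, b :: l₂, h => (P.comp l₁ l₂ h h hr).flip (U b) +
      sumCompFromLin hr (l₁ ++ [b]) l₂ (by simp [h])

theorem sumCompFromLin_apply {c : C} {l : List C} {n r : ℤ} (hr : r = n + d) (x : P.obj c l n)
    (l₁ l₂ : List C) (h : l = l₁ ++ l₂) :
    P.sumCompFromLin U hr l₁ l₂ h x = P.sumCompFrom U hr x l₁ l₂ h := by
  induction l₂ generalizing l₁ with
  | nil => rfl
  | cons b l₂ ih => rw [sumCompFrom_cons, ← ih]; rfl

/-- Summands of `∑ (x ∘ y) ∘ᵢ u` for inputs of `x` after the one into which `y` is plugged. -/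
theorem sumCompFrom_comp_right {c b : C} {e m f : List C} {p q r p' r' : ℤ}
    (l₁ l₂ l₂' l₂'' : List C)
    (he : e = l₁ ++ b :: l₂) (hf : f = l₁ ++ (m ++ l₂)) (hl : l₂ = l₂' ++ l₂'') (hr : r = p + q)
    (hp : p' = p + d) (hr' : r' = r + d) (hs : r' = p' + q) (x : P.obj c e p) (z : P.obj b m q) :
    P.sumCompFrom U hr' (P.comp l₁ l₂ he hf hr x z) (l₁ ++ (m ++ l₂')) l₂'' (by simp [hf, hl]) =
      ksgn k (d * q) • P.comp l₁ l₂ he hf hs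
        (P.sumCompFrom U hp x (l₁ ++ b :: l₂') l₂'' (by simp [he, hl])) z := by
  subst hl
  induction l₂'' generalizing l₂' with
  | nil => simp [sumCompFrom_nil]
  | cons a l₂'' ih =>
    rw [sumCompFrom_cons, sumCompFrom_cons, map_add, LinearMap.add_apply, smul_add]
    congr 1
    -- Inserting the unary `U a` leaves the list of inputs unchanged, so the same lists serve before
    -- and after the insertion.
    · have := P.comp_comm l₁ l₂' l₂'' (a := b) (b := a) he (by simp [he]) hf (by simp [hf])
        (e₁ := f) (e₂ := e) (f := f) (n := [a])
        (by simp [he]) (by simp [he]) (by simp [hf]) (by simp [hf]) hr hr' hp hs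
        x z (U a)
      rw [this, mul_comm q d]
      rfl
    · have := ih (l₂' ++ [a]) (by simp [he]) (by simp [hf])
      rw [P.sumCompFrom_congr_lists U hr' _
          (show l₁ ++ (m ++ l₂') ++ [a] = l₁ ++ (m ++ (l₂' ++ [a])) by simp)
        rfl, P.sumCompFrom_congr_lists U hp _
          (show l₁ ++ b :: l₂' ++ [a] = l₁ ++ b :: (l₂' ++ [a]) by simp)
        rfl, P.comp_congr_lists rfl (show l₂' ++ a :: l₂'' = l₂' ++ [a] ++ l₂'' by simp),
        P.comp_congr_lists rfl (show l₂' ++ a :: l₂'' = l₂' ++ [a] ++ l₂'' by simp)]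
      exact this

/-- Summands of `∑ (x ∘ y) ∘ᵢ u` for inputs of `y`. -/
theorem sumCompFrom_comp_mid {c b : C} {e m f : List C} {p q r q' r' : ℤ} (l₁ l₂ m' m'' : List C)
    (he : e = l₁ ++ b :: l₂) (hf : f = l₁ ++ (m ++ l₂)) (hm : m = m' ++ m'') (hr : r = p + q)
    (hq : q' = q + d) (hr' : r' = r + d) (hs : r' = p + q') (x : P.obj c e p) (z : P.obj b m q) :
    P.sumCompFrom U hr' (P.comp l₁ l₂ he hf hr x z) (l₁ ++ m') (m'' ++ l₂) (by simp [hf, hm]) =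
      P.comp l₁ l₂ he hf hs x (P.sumCompFrom U hq z m' m'' hm) +
      P.sumCompFrom U hr' (P.comp l₁ l₂ he hf hr x z) (l₁ ++ m) l₂ (by simp [hf]) := by
  induction m'' generalizing m' with
  | nil =>
    obtain rfl : m = m' := by simpa using hm
    rw [sumCompFrom_nil, map_zero, zero_add]; rfl
  | cons a m'' ih =>
    rw [sumCompFrom_cons, map_add, add_assoc]
    have := ih (m' ++ [a]) (by simp [hm])
    rw [← this]
    refine (sumCompFrom_cons ..).trans ?_
    congr 1
    · exact P.comp_assoc l₁ l₂ m' m'' he hm hf (by simp [hf, hm]) hm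
        (by simp [hf, hm]) hf hr hr' hq hs x z (U a)
    · exact P.sumCompFrom_congr_lists U hr' _ (by simp) rfl _

/-- Summands of `∑ (x ∘ y) ∘ᵢ u` for inputs of `x` before the one into which `y` is plugged. -/
theorem sumCompFrom_comp_left {c b : C} {e m f : List C} {p q r p' r' : ℤ} (l₁ l₂ l₁' l₁'' : List C)
    (he : e = l₁ ++ b :: l₂) (hf : f = l₁ ++ (m ++ l₂)) (hl : l₁ = l₁' ++ l₁'') (hr : r = p + q)
    (hp : p' = p + d) (hr' : r' = r + d) (hs : r' = p' + q) (x : P.obj c e p) (z : P.obj b m q) :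
    ksgn k (d * q) • P.comp l₁ l₂ he hf hs
        (P.sumCompFrom U hp x l₁' (l₁'' ++ b :: l₂) (by simp [he, hl])) z +
      P.sumCompFrom U hr' (P.comp l₁ l₂ he hf hr x z) l₁ (m ++ l₂) hf =
    P.sumCompFrom U hr' (P.comp l₁ l₂ he hf hr x z) l₁' (l₁'' ++ (m ++ l₂)) (by simp [hf, hl]) +
      ksgn k (d * q) • P.comp l₁ l₂ he hf hs (P.sumCompFrom U hp x l₁ (b :: l₂) he) z := by
  -- The sum over the inputs in `l₁''` is the difference of two tail sums, starting at `l₁'` and at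
  -- `l₁`. The identity is stated with the subtracted terms moved across, so that the induction
  -- stays additive.
  induction l₁'' generalizing l₁' with
  | nil =>
    obtain rfl : l₁ = l₁' := by simpa using hl
    exact add_comm _ _
  | cons a l₁'' ih =>
    have := ih (l₁' ++ [a]) (by simp [hl])
    have e1 := sumCompFrom_cons P U hp x l₁' (l₁'' ++ b :: l₂) (b := a) (by simp [he, hl])
    have e2 := sumCompFrom_cons P U hr' (P.comp l₁ l₂ he hf hr x z) l₁' (l₁'' ++ (m ++ l₂))
      (b := a) (by simp [hf, hl])
    refine (congrArg (fun X => ksgn k (d * q) • P.comp l₁ l₂ he hf hs X z +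
      P.sumCompFrom U hr' (P.comp l₁ l₂ he hf hr x z) l₁ (m ++ l₂) hf) e1).trans ?_
    refine Eq.trans ?_ (congrArg (fun X => X +
      ksgn k (d * q) • P.comp l₁ l₂ he hf hs (P.sumCompFrom U hp x l₁ (b :: l₂) he) z) e2).symm
    rw [map_add, LinearMap.add_apply, smul_add, add_assoc, add_assoc, this]
    congr 1
    have h := P.comp_comm l₁' l₁'' l₂ (a := a) (b := b) (e := e) (e₁ := e) (e₂ := f) (f := f)
      (m := [a]) (n := m)
      (by simp [he, hl]) (by simp [he, hl]) (by simp [he, hl]) (by simp [he, hl])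
      (by simp [hf, hl]) (by simp [hf, hl]) (by simp [hf, hl]) (by simp [hf, hl])
      hp hs hr hr' x (U a) z
    rw [P.comp_congr_lists (show l₁ = l₁' ++ ([a] ++ l₁'') by simp [hl]) rfl,
      P.comp_congr_lists (l₁ := l₁) (show l₁ = l₁' ++ a :: l₁'' by simp [hl]) rfl]
    refine (congrArg _ h).trans ?_
    -- The sign of exchanging `U a` with `z` cancels the sign in front of the sum.
    rw [smul_smul, ksgn_mul_self, one_smul]

theorem map_sumCompFrom {P : GradedOperad.{u, v, w} k C} {Q : GradedOperad.{u, v, x} k C}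
    (f : Hom P Q) (U : ∀ c, P.obj c [c] d) {c : C} {l : List C} {n r : ℤ} (hr : r = n + d)
    (x : P.obj c l n) (l₁ l₂ : List C) (h : l = l₁ ++ l₂) :
    f.map (P.sumCompFrom U hr x l₁ l₂ h) =
      Q.sumCompFrom (fun c => f.map (U c)) hr (f.map x) l₁ l₂ h := by
  induction l₂ generalizing l₁ with
  | nil => exact map_zero _
  | cons b l₂ ih => rw [sumCompFrom_cons, sumCompFrom_cons, map_add, ih, f.map_comp]

theorem sumCompFrom_zero {c : C} {l : List C} {n r : ℤ} (hr : r = n + d)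
    (x : P.obj c l n) (l₁ l₂ : List C) (h : l = l₁ ++ l₂) :
    P.sumCompFrom (fun c => (0 : P.obj c [c] d)) hr x l₁ l₂ h = 0 := by
  induction l₂ generalizing l₁ with
  | nil => rfl
  | cons b l₂ ih => rw [sumCompFrom_cons, ih, map_zero, add_zero]

theorem sumCompFrom_add (V : ∀ c, P.obj c [c] d) {c : C} {l : List C} {n r : ℤ} (hr : r = n + d)
    (x : P.obj c l n) (l₁ l₂ : List C) (h : l = l₁ ++ l₂) :
    P.sumCompFrom (fun c => U c + V c) hr x l₁ l₂ h =
      P.sumCompFrom U hr x l₁ l₂ h + P.sumCompFrom V hr x l₁ l₂ h := by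
  induction l₂ generalizing l₁ with
  | nil => exact (add_zero _).symm
  | cons b l₂ ih => simp only [sumCompFrom_cons, ih, map_add]; abel

theorem sumCompFrom_smul (a : k) {c : C} {l : List C} {n r : ℤ} (hr : r = n + d)
    (x : P.obj c l n) (l₁ l₂ : List C) (h : l = l₁ ++ l₂) :
    P.sumCompFrom (fun c => a • U c) hr x l₁ l₂ h = a • P.sumCompFrom U hr x l₁ l₂ h := by
  induction l₂ generalizing l₁ with
  | nil => exact (smul_zero _).symm
  | cons b l₂ ih => simp only [sumCompFrom_cons, ih, map_smul, smul_add]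

end SumComp

/-! ### Inner derivations -/

/-- The inner derivation `x ↦ U ∘ x - (-1)^(d|x|) ∑ᵢ x ∘ᵢ U` of degree `d`. -/
def inner (P : GradedOperad.{u, v, w} k C) {d : ℤ} (U : ∀ c, P.obj c [c] (0 + d)) :
    CollHom P P d := fun c l n =>
  P.comp [] [] (show [c] = [] ++ c :: [] from rfl) (by simp)
      (show n + d = 0 + d + n by omega) (U c) -
    ksgn k (d * n) • P.sumCompFromLin U (show n + d = n + (0 + d) by omega) [] l rfl

theorem inner_apply (P : GradedOperad.{u, v, w} k C) {d : ℤ} (U : ∀ c, P.obj c [c] (0 + d))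
    {c : C} {l : List C} {n : ℤ} (x : P.obj c l n) :
    P.inner U c l n x =
      P.comp [] [] (show [c] = [] ++ c :: [] from rfl) (by simp) (show n + d = 0 + d + n by omega)
        (U c) x -
      ksgn k (d * n) • P.sumComp U (show n + d = n + (0 + d) by omega) x := by
  rw [inner, LinearMap.sub_apply, LinearMap.smul_apply, sumCompFromLin_apply]
  rfl

/-- The inputs of `x ∘ z` are those of `x` before the plugged one, those of `z`, and those of `x`
after it; the three preceding lemmas treat these in turn. The Leibniz rule has one additional pair
of terms: `U` inserted into the plugged input of `x`, and `U` composed on the output of `z`. They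
cancel by associativity. -/
theorem inner_isDer (P : GradedOperad.{u, v, w} k C) {d : ℤ} (U : ∀ c, P.obj c [c] (0 + d)) :
    IsDer (Hom.id P) (P.inner U) := by
  intro c b e m g p q r l₁ l₂ he hg hr x z
  subst he hg
  have he : l₁ ++ b :: l₂ = l₁ ++ b :: l₂ := rfl
  have hg : l₁ ++ (m ++ l₂) = l₁ ++ (m ++ l₂) := rfl
  have A := P.sumCompFrom_comp_left U l₁ l₂ [] l₁ he hg rfl hr (p' := p + d) (r' := r + d)
    (by omega) (by omega) (by omega) x z
  have B := P.sumCompFrom_comp_mid U l₁ l₂ [] m he hg rfl hr (q' := q + d) (r' := r + d)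
    (by omega) (by omega) (by omega) x z
  have D := P.sumCompFrom_comp_right U l₁ l₂ [] l₂ he hg rfl hr (p' := p + d) (r' := r + d)
    (by omega) (by omega) (by omega) x z
  have B' := (P.sumCompFrom_congr_lists U (show r + d = r + (0 + d) by omega)
    (P.comp l₁ l₂ he hg hr x z) (show l₁ = l₁ ++ [] by simp) rfl hg).trans B
  have D' := (P.sumCompFrom_congr_lists U (show r + d = r + (0 + d) by omega)
    (P.comp l₁ l₂ he hg hr x z) (show l₁ ++ m = l₁ ++ (m ++ []) by simp) rfl (by simp)).trans D
  rw [sumCompFrom_cons, map_add, LinearMap.add_apply, smul_add] at A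
  -- `F` is the cancelling pair `(x ∘ U) ∘ z = x ∘ (U ∘ z)`; `G` below moves `U` to the output of
  -- the whole composite.
  have F := P.comp_assoc l₁ l₂ [] [] he (b := b) (a := b) (m := [b]) (m' := m) (n := m)
    (e' := l₁ ++ b :: l₂) (f := l₁ ++ (m ++ l₂)) rfl (by simp) (by simp) (by simp) (by simp) hg
    (r := p + d) (s := q) (t := q + d) (u := r + d)
    (by omega) (by omega) (by omega) (by omega) x (U b) z
  have G := P.comp_assoc [] [] l₁ l₂ (b := c) (e := [c]) (e' := l₁ ++ b :: l₂)
    (m' := l₁ ++ (m ++ l₂)) (f := l₁ ++ (m ++ l₂)) rfl he (by simp) (by simp) hg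
    (by simp) (by simp) (r := p + d) (u := r + d) (t := r)
    (by omega) (by omega) hr (by omega) (U c) x z
  have G' := (P.comp_congr_lists (show l₁ = [] ++ l₁ by simp) (show l₂ = l₂ ++ [] by simp) he hg
    (show r + d = p + d + q by omega) _ z).trans G
  have F' := (P.comp_congr_lists (show l₁ = l₁ ++ [] by simp) (show l₂ = [] ++ l₂ by simp) he hg
    (show r + d = p + d + q by omega) _ z).trans F
  simp only [inner_apply, sumComp, map_sub, map_smul, LinearMap.sub_apply, LinearMap.smul_apply,
    Hom.id, LinearMap.id_apply]
  rw [← G', ← F']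
  have e₀ : ksgn k ((0 + d) * q) = ksgn k (d * q) := by rw [zero_add]
  have e₁ : ksgn k (d * r) = ksgn k (d * p) * ksgn k (d * q) := by rw [hr, mul_add, ksgn_add]
  rw [B', D', e₀] at A
  have A' := eq_sub_of_add_eq A.symm
  rw [A', e₁]
  -- Only the relation `β² = 1` between the signs is needed from here on.
  have hs := ksgn_mul_self k (d * q)
  generalize ksgn k (d * p) = α at *
  generalize ksgn k (d * q) = β at *
  match_scalars
  all_goals first | ring1 | linear_combination α * hs | linear_combination -α * hs

end GradedOperad
end OperadLemmas

/-! ### Derivations along a morphism and their composites -/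

section DerivationLemmas

open GradedOperad FreeOperad

variable {k : Type u} [Field k] {C : Type v}

section General

variable {P' : GradedOperad.{u, v, z} k C} {P : GradedOperad.{u, v, w} k C}
  {Q : GradedOperad.{u, v, x} k C} {Q' : GradedOperad.{u, v, y} k C} {d e d' : ℤ}

/-- The Leibniz rule for `1 ∘ 1 = 1` reads `θ(1) = θ(1) + θ(1)`. This makes the unit condition on
deformations automatic. -/
theorem IsDer.map_one {f : Hom P Q} {θ : CollHom P Q d} (hθ : IsDer f θ) (c : C) :
    θ c [c] 0 (P.one c) = 0 := by
  have h := hθ [] [] (show [c] = [] ++ c :: [] from rfl) (show [c] = [] ++ ([c] ++ []) from rfl)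
    (show (0 : ℤ) = 0 + 0 from rfl) (P.one c) (P.one c)
  rw [P.one_comp, f.map_one, Q.comp_one_cast, Q.one_comp_cast, mul_zero, ksgn_zero, one_smul] at h
  have h' : θ c [c] 0 (P.one c) = θ c [c] 0 (P.one c) + θ c [c] 0 (P.one c) := h
  simpa using h'

theorem IsDer.congr_hom {f f' : Hom P Q} {θ : CollHom P Q d} (hθ : IsDer f θ)
    (h : ∀ {c : C} {l : List C} {n : ℤ} (a : P.obj c l n), f.map a = f'.map a) : IsDer f' θ := by
  intro c b e m g p q r l₁ l₂ he hg hr a a'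
  rw [hθ l₁ l₂ he hg hr a a', h, h]

theorem IsDer.sub {f : Hom P Q} {θ θ' : CollHom P Q d} (hθ : IsDer f θ) (hθ' : IsDer f θ') :
    IsDer f (θ - θ') := by
  intro c b e m g p q r l₁ l₂ he hg hr a a'
  simp only [Pi.sub_apply, LinearMap.sub_apply, map_sub, hθ l₁ l₂ he hg hr a a',
    hθ' l₁ l₂ he hg hr a a', smul_sub]
  abel

theorem isDer_zero (f : Hom P Q) : IsDer f (0 : CollHom P Q d) := by
  intro; simp

/-- The composition of a morphism of operads with a collection morphism. -/
def compHom (f : Hom P' P) : CollHom P Q d →ₗ[k] CollHom P' Q d where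
  toFun θ := fun c l n => θ c l n ∘ₗ f.map
  map_add' _ _ := rfl
  map_smul' _ _ := rfl

theorem compHom_apply (f : Hom P' P) (θ : CollHom P Q d) {c : C} {l : List C} {n : ℤ}
    (a : P'.obj c l n) : compHom f θ c l n a = θ c l n (f.map a) := rfl

theorem IsDer.compHom {g : Hom P' P} {f : Hom P Q} {θ : CollHom P Q d} (hθ : IsDer f θ) :
    IsDer (g.trans f) (compHom g θ) := by
  intro c b e m g' p q r l₁ l₂ he hg hr a a'
  rw [compHom_apply, g.map_comp, hθ l₁ l₂ he hg hr]
  rfl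

theorem IsDer.hom_comp {f : Hom P Q} {θ : CollHom P Q d} (hθ : IsDer f θ) (g : Hom Q Q') :
    IsDer (f.trans g) (fun c l n => g.map ∘ₗ θ c l n : CollHom P Q' d) := by
  intro c b e m g' p q r l₁ l₂ he hg hr a a'
  simp only [LinearMap.comp_apply, hθ l₁ l₂ he hg hr, map_add, map_smul, g.map_comp]
  rfl

/-- `θ ↦ θ ∘ D` for a collection morphism `D` of degree `e`. -/
def compColl (D : CollHom P' P e) (h : d' = d + e) : CollHom P Q d →ₗ[k] CollHom P' Q d' where
  toFun θ := fun c l n => Q.castDeg (show n + e + d = n + d' by omega) ∘ₗ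
    θ c l (n + e) ∘ₗ D c l n
  map_add' θ θ' := by ext; simp
  map_smul' a θ := by ext; simp

theorem compColl_apply (D : CollHom P' P e) (h : d' = d + e) (θ : CollHom P Q d) {c : C}
    {l : List C} {n : ℤ} (a : P'.obj c l n) :
    compColl D h θ c l n a =
      Q.castDeg (show n + e + d = n + d' by omega) (θ c l (n + e) (D c l n a)) := rfl

theorem codiff_eq_compColl (D : CollHom P P (-1)) (h : d' = d - 1) :
    codiff D Q h = compColl D (show d' = d + -1 from h) := rfl

/-- A composite of two derivations fails the Leibniz rule only by mixed terms in which one factor is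
`f (D a)`; `hf` removes them. The signs `(-1)^(ep)` and `(-1)^(dp)` multiply to that of degree `d +
e`. -/
theorem IsDer.compColl {i : Hom P' P} {f : Hom P Q} {D : CollHom P' P e} {θ : CollHom P Q d}
    (hD : IsDer i D) (hθ : IsDer f θ) (h : d' = d + e)
    (hf : ∀ {c : C} {l : List C} {n : ℤ} (a : P'.obj c l n), f.map (D c l n a) = 0) :
    IsDer (i.trans f) (compColl D h θ) := by
  intro c b E m g p q r l₁ l₂ he hg hr a a'
  rw [compColl_apply, hD l₁ l₂ he hg hr a a', map_add, map_smul,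
    hθ l₁ l₂ he hg (show r + e = p + e + q by omega),
    hθ l₁ l₂ he hg (show r + e = p + (q + e) by omega), hf, hf, map_zero,
    map_zero, LinearMap.zero_apply, smul_zero, add_zero, zero_add, compColl_apply, compColl_apply]
  simp only [map_add, map_smul, castDeg_comp, comp_castDeg_left, comp_castDeg_right, smul_smul]
  subst h
  rw [add_mul, ksgn_add, mul_comm (ksgn k (d * p))]
  rfl

/-- Transport of collection morphisms along an equality of degrees. -/
def castColl (h : d = d') : CollHom P Q d ≃ₗ[k] CollHom P Q d' :=
  LinearEquiv.ofLinearMap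
    { toFun := fun θ c l n => Q.castDeg (by rw [h]) ∘ₗ θ c l n
      map_add' := by intros; ext; simp
      map_smul' := by intros; ext; simp }
    { toFun := fun θ c l n => Q.castDeg (by rw [h]) ∘ₗ θ c l n
      map_add' := by intros; ext; simp
      map_smul' := by intros; ext; simp }
    (by subst h; rfl) (by subst h; rfl)

theorem castColl_apply (h : d = d') (θ : CollHom P Q d) {c : C} {l : List C} {n : ℤ}
    (a : P.obj c l n) : castColl h θ c l n a = Q.castDeg (by rw [h]) (θ c l n a) := rfl

theorem castColl_isDer {f : Hom P Q} (h : d = d') {θ : CollHom P Q d} :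
    IsDer f (castColl h θ) ↔ IsDer f θ := by
  subst h; rfl

/-- The inner derivations `a ↦ U ∘ f a - (-1)^(d|a|) ∑ᵢ f a ∘ᵢ U` along `f`. -/
def innerDer (f : Hom P Q) (d : ℤ) : (∀ c, Q.obj c [c] (0 + d)) →ₗ[k] CollHom P Q d where
  toFun U := compHom f (Q.inner U)
  map_add' U V := by
    funext c l n
    ext a
    simp only [compHom_apply, Pi.add_apply, LinearMap.add_apply, inner_apply, sumComp,
      map_add]
    rw [sub_add_sub_comm, ← smul_add]
    congr 2
    exact Q.sumCompFrom_add U V _ _ _ _ _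
  map_smul' t U := by
    funext c l n
    ext a
    simp only [compHom_apply, Pi.smul_apply, LinearMap.smul_apply, inner_apply, sumComp,
      map_smul, RingHom.id_apply, smul_sub]
    congr 1
    rw [smul_comm t]
    congr 1
    exact Q.sumCompFrom_smul U t _ _ _ _ _

theorem innerDer_apply (f : Hom P Q) (U : ∀ c, Q.obj c [c] (0 + d)) {c : C} {l : List C} {n : ℤ}
    (a : P.obj c l n) : innerDer f d U c l n a = Q.inner U c l n (f.map a) := rfl

theorem innerDer_isDer (f : Hom P Q) (U : ∀ c, Q.obj c [c] (0 + d)) :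
    IsDer f (innerDer f d U) :=
  IsDer.compHom (g := f) (Q.inner_isDer U)

/-- The value of a derivation on `∑ᵢ a ∘ᵢ U` if `U` is killed by the underlying morphism. -/
theorem IsDer.map_sumCompFrom {f : Hom P Q} {θ : CollHom P Q d} (hθ : IsDer f θ)
    (U : ∀ c, P.obj c [c] e)
    (hU : ∀ c, f.map (U c) = 0) {c : C} {l : List C} {n r : ℤ} (hr : r = n + e)
    (a : P.obj c l n) (l₁ l₂ : List C) (h : l = l₁ ++ l₂) :
    θ c l r (P.sumCompFrom U hr a l₁ l₂ h) =
      ksgn k (d * n) • Q.sumCompFrom (fun b => θ b [b] e (U b)) (show r + d = n + (e + d) by omega)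
        (f.map a) l₁ l₂ h := by
  induction l₂ generalizing l₁ with
  | nil => rw [sumCompFrom_nil, sumCompFrom_nil, map_zero, smul_zero]
  | cons b l₂ ih =>
    rw [sumCompFrom_cons, sumCompFrom_cons, map_add, ih, hθ, hU, map_zero, zero_add, smul_add]

end General

/-! ### Derivations out of free operads and the TJ-grading -/

section Free

variable {S : C → List C → ℤ → Type w} {Q : GradedOperad.{u, v, x} k C} {d : ℤ}

/-- The class of a monomial, as an element of the free operad. -/
noncomputable def FreeOperad.monomial (k : Type u) [Field k] {c : C} {l : List C} {n : ℤ}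
    (X : OpMonomial S c l n) : (freeOperad k S).obj c l n :=
  mono k X

theorem FreeOperad.monomial_comp {c b : C} {e m f : List C} {p q r : ℤ} (l₁ l₂ : List C)
    (he : e = l₁ ++ b :: l₂) (hf : f = l₁ ++ (m ++ l₂)) (hr : r = p + q)
    (X : OpMonomial S c e p) (Y : OpMonomial S b m q) :
    monomial k (.comp l₁ l₂ he hf hr X Y) =
      (freeOperad k S).comp l₁ l₂ he hf hr (monomial k X) (monomial k Y) :=
  (comp_mono k l₁ l₂ he hf hr X Y).symm

theorem FreeOperad.linearMap_ext {c : C} {l : List C} {n : ℤ} {M : Type*} [AddCommGroup M]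
    [Module k M] {φ ψ : (freeOperad k S).obj c l n →ₗ[k] M}
    (h : ∀ X, φ (monomial k X) = ψ (monomial k X)) : φ = ψ :=
  obj_hom_ext k h

theorem FreeOperad.span_monomial (c : C) (l : List C) (n : ℤ) :
    Submodule.span k (Set.range (monomial k : OpMonomial S c l n → _)) = ⊤ := by
  refine Submodule.eq_top_iff'.2 fun a => ?_
  obtain ⟨ξ, rfl⟩ := Submodule.Quotient.mk_surjective _ a
  rw [← Finsupp.range_linearCombination]
  exact ⟨ξ, (mk_eq k ξ).symm⟩

/-- The uniqueness counterpart of `derExt`. It reduces every identity between derivations below to a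
check on generators. -/
theorem IsDer.ext_gen {f : Hom (freeOperad k S) Q} {θ θ' : CollHom (freeOperad k S) Q d}
    (hθ : IsDer f θ) (hθ' : IsDer f θ')
    (h : ∀ {c : C} {l : List C} {n : ℤ} (g : S c l n), θ c l n (gen k g) = θ' c l n (gen k g)) :
    θ = θ' := by
  funext c l n
  refine linearMap_ext fun X => ?_
  induction X with
  | gen g => exact h g
  | one c => exact (hθ.map_one c).trans (hθ'.map_one c).symm
  | comp l₁ l₂ he hf hr X Y ihX ihY =>
    rw [monomial_comp]
    refine (hθ l₁ l₂ he hf hr _ _).trans (Eq.trans ?_ (hθ' l₁ l₂ he hf hr _ _).symm)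
    rw [ihX, ihY]

theorem FreeOperad.hom_ext_gen {f f' : Hom (freeOperad k S) Q}
    (h : ∀ {c : C} {l : List C} {n : ℤ} (g : S c l n), f.map (gen k g) = f'.map (gen k g))
    {c : C} {l : List C} {n : ℤ} (a : (freeOperad k S).obj c l n) : f.map a = f'.map a := by
  refine LinearMap.congr_fun (linearMap_ext fun X => ?_) a
  clear a
  induction X with
  | gen g => exact h g
  | one c => exact (f.map_one c).trans (f'.map_one c).symm
  | comp l₁ l₂ he hf hr X Y ihX ihY =>
    rw [monomial_comp, f.map_comp, f'.map_comp, ihX, ihY]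

variable {tj : ∀ {c : C} {l : List C} {n : ℤ}, S c l n → ℕ}

theorem GradedOperad.Hom.map_monomial_eq_zero {f : Hom (freeOperad k S) Q}
    (hf : ∀ {c : C} {l : List C} {n : ℤ} (g : S c l n), tj g ≠ 0 → f.map (gen k g) = 0)
    {c : C} {l : List C} {n : ℤ} (X : OpMonomial S c l n) (hX : X.tjDeg tj ≠ 0) :
    f.map (monomial k X) = 0 := by
  induction X with
  | gen g => exact hf g hX
  | one c => exact absurd rfl hX
  | comp l₁ l₂ he hg hr X Y ihX ihY =>
    rw [monomial_comp]
    refine (f.map_comp l₁ l₂ he hg hr _ _).trans ?_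
    by_cases h : X.tjDeg tj = 0
    · rw [ihY (fun h' => hX (by simp [OpMonomial.tjDeg, h, h'])), map_zero]
    · rw [ihX h, map_zero, LinearMap.zero_apply]

/-- The derivation acts on one generator of a monomial, and `f` on all the others. A nonzero term
needs degree `j` at the former and degree `0` at the latter, hence total degree `j`. -/
theorem IsDer.monomial_eq_zero {f : Hom (freeOperad k S) Q} {θ : CollHom (freeOperad k S) Q d}
    (hθ : IsDer f θ)
    (hf : ∀ {c : C} {l : List C} {n : ℤ} (g : S c l n), tj g ≠ 0 → f.map (gen k g) = 0)
    {j : ℤ} (hj : ∀ {c : C} {l : List C} {n : ℤ} (g : S c l n), (tj g : ℤ) ≠ j →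
      θ c l n (gen k g) = 0)
    {c : C} {l : List C} {n : ℤ} (X : OpMonomial S c l n) (hX : (X.tjDeg tj : ℤ) ≠ j) :
    θ c l n (monomial k X) = 0 := by
  induction X with
  | gen g => exact hj g hX
  | one c => exact hθ.map_one c
  | comp l₁ l₂ he hg hr X Y ihX ihY =>
    rw [monomial_comp]
    refine (hθ l₁ l₂ he hg hr _ _).trans ?_
    simp only [OpMonomial.tjDeg, Nat.cast_add] at hX
    have h₁ : θ _ _ _ (monomial k X) = 0 ∨ f.map (monomial k Y) = 0 := by
      by_cases h : (X.tjDeg tj : ℤ) = j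
      · exact .inr (f.map_monomial_eq_zero hf Y (by omega))
      · exact .inl (ihX h)
    have h₂ : f.map (monomial k X) = 0 ∨ θ _ _ _ (monomial k Y) = 0 := by
      by_cases h : (Y.tjDeg tj : ℤ) = j
      · exact .inl (f.map_monomial_eq_zero hf X (by omega))
      · exact .inr (ihY h)
    rcases h₁ with h | h <;> rcases h₂ with h' | h' <;> simp [h, h']

theorem IsDer.tjPart_eq_zero {f : Hom (freeOperad k S) Q} {θ : CollHom (freeOperad k S) Q d}
    (hθ : IsDer f θ)
    (hf : ∀ {c : C} {l : List C} {n : ℤ} (g : S c l n), tj g ≠ 0 → f.map (gen k g) = 0)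
    {j : ℤ} (hj : ∀ {c : C} {l : List C} {n : ℤ} (g : S c l n), (tj g : ℤ) ≠ j →
      θ c l n (gen k g) = 0)
    {i : ℤ} (hi : i ≠ j) {c : C} {l : List C} {n : ℤ} {a : (freeOperad k S).obj c l n}
    (ha : a ∈ tjPart k tj i c l n) : θ c l n a = 0 := by
  have : tjPart k tj i c l n ≤ LinearMap.ker (θ c l n) := by
    refine Submodule.span_le.2 ?_
    rintro _ ⟨X, hX, rfl⟩
    exact hθ.monomial_eq_zero hf hj X (hX ▸ hi)
  exact this ha

/-- Every element has a component of `TJ`-degree zero. -/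
theorem exists_tjPart_zero (tj : ∀ {c : C} {l : List C} {n : ℤ}, S c l n → ℕ)
    {c : C} {l : List C} {n : ℤ} (a : (freeOperad k S).obj c l n) :
    ∃ a₀ ∈ tjPart k tj 0 c l n,
      a - a₀ ∈
        Submodule.span k {b | ∃ X : OpMonomial S c l n, X.tjDeg tj ≠ 0 ∧ b = monomial k X} := by
  -- Only the sum of the two subspaces is used, not its directness: the maps applied later vanish on
  -- the second one.
  have key : a ∈ tjPart k tj 0 c l n ⊔
      Submodule.span k {b | ∃ X : OpMonomial S c l n, X.tjDeg tj ≠ 0 ∧ b = monomial k X} := by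
    refine (Submodule.span_le.2 ?_ : Submodule.span k (Set.range (monomial k)) ≤ _)
      ((span_monomial (k := k) (S := S) c l n).symm ▸ Submodule.mem_top)
    rintro _ ⟨X, rfl⟩
    by_cases h : X.tjDeg tj = 0
    · exact Submodule.mem_sup_left (Submodule.subset_span ⟨X, by simp [h], rfl⟩)
    · exact Submodule.mem_sup_right (Submodule.subset_span ⟨X, h, rfl⟩)
  obtain ⟨a₀, h₀, b, hb, rfl⟩ := Submodule.mem_sup.1 key
  exact ⟨a₀, h₀, by rwa [add_sub_cancel_left]⟩

theorem map_eq_of_sub_mem_span {c : C} {l : List C} {n : ℤ}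
    {p : OpMonomial S c l n → Prop} {a a₀ : (freeOperad k S).obj c l n}
    (h : a - a₀ ∈ Submodule.span k {b | ∃ X : OpMonomial S c l n, p X ∧ b = monomial k X})
    {M : Type*} [AddCommGroup M] [Module k M] (φ : (freeOperad k S).obj c l n →ₗ[k] M)
    (hφ : ∀ X : OpMonomial S c l n, p X → φ (monomial k X) = 0) : φ a = φ a₀ := by
  have : Submodule.span k {b | ∃ X : OpMonomial S c l n, p X ∧ b = monomial k X} ≤
      LinearMap.ker φ := by
    refine Submodule.span_le.2 ?_
    rintro _ ⟨X, hX, rfl⟩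
    exact hφ X hX
  exact sub_eq_zero.1 ((map_sub φ a a₀).symm.trans (this h))

end Free

end DerivationLemmas

/-! ### The operad of algebras with derivation, over `𝒜` -/

section ResolutionLemmas

open GradedOperad FreeOperad

variable {k : Type u} [Field k] {C : Type v}

namespace TJResolution

variable {𝒜 : GradedOperad.{u, v, w} k C} (R : TJResolution.{u, v, w, x} 𝒜)

theorem incl_gen {c : C} {l : List C} {n : ℤ} (g : R.X c l n) :
    R.incl.map (gen k g) = gen k (DRGen.x g) :=
  lift_gen _ _ g

theorem s_gen {c : C} {l : List C} {n : ℤ} (g : R.X c l n) :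
    R.s c l n (gen k g) = gen k (DRGen.ux g) :=
  derExt_gen _ _ _ g

theorem dDR_gen {c : C} {l : List C} {n : ℤ} (g : DRGen R.X c l n) :
    R.dDR c l n (gen k g) = R.dDRGen c l n g :=
  derExt_gen _ _ _ g

theorem ρDR_gen_x {c : C} {l : List C} {n : ℤ} (g : R.X c l n) :
    R.ρDR.map (gen k (DRGen.x g)) = R.ρ.map (gen k g) :=
  lift_gen _ _ _

theorem ρDR_gen_phi (c : C) : R.ρDR.map (gen k (DRGen.phi c)) = 0 :=
  lift_gen _ _ _

theorem ρDR_gen_ux {c : C} {l : List C} {n : ℤ} (g : R.X c l n) :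
    R.ρDR.map (gen k (DRGen.ux g)) = 0 :=
  lift_gen _ _ _

theorem s_isDer : IsDer R.incl R.s := derExt_isDer _ _ _

theorem dDR_isDer : IsDer (Hom.id R.DR) R.dDR := derExt_isDer _ _ _

theorem ρDR_incl {c : C} {l : List C} {n : ℤ} (a : R.operad.obj c l n) :
    R.ρDR.map (R.incl.map a) = R.ρ.map a :=
  hom_ext_gen (f := R.incl.trans R.ρDR) (f' := R.ρ)
    (fun g => (congrArg _ (R.incl_gen g)).trans (R.ρDR_gen_x g)) a

theorem ρDR_s {c : C} {l : List C} {n : ℤ} (a : R.operad.obj c l n) :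
    R.ρDR.map (R.s c l n a) = 0 := by
  have := IsDer.ext_gen (IsDer.hom_comp R.s_isDer R.ρDR) (isDer_zero _)
    (fun g => (congrArg _ (R.s_gen g)).trans (R.ρDR_gen_ux g))
  exact LinearMap.congr_fun (congrFun (congrFun (congrFun this c) l) n) a

/-- The composite is a derivation, so generators suffice. On `X` it is `ρ ∂ = 0`; on `↑X` two terms
contain `φ` and the third lies in the image of `s`, and all of these are killed. -/
theorem ρDR_dDR {c : C} {l : List C} {n : ℤ} (a : R.DR.obj c l n) :
    R.ρDR.map (R.dDR c l n a) = 0 := by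
  have := IsDer.ext_gen (IsDer.hom_comp R.dDR_isDer R.ρDR) (isDer_zero _) (fun g => by
    refine (congrArg _ (R.dDR_gen g)).trans ?_
    cases g with
    | x g => exact (R.ρDR_incl _).trans (R.ρ_d _ _ _ _)
    | phi => exact map_zero _
    | ux g =>
      change R.ρDR.map (R.dDRGen _ _ _ (.ux g)) = 0
      simp only [dDRGen, map_sub, sumComp, map_sumCompFrom, Hom.map_comp, Hom.map_castDeg, ρDR_s,
        ρDR_gen_phi, sumCompFrom_zero, map_zero, LinearMap.zero_apply, sub_zero])
  exact LinearMap.congr_fun (congrFun (congrFun (congrFun this c) l) n) a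

variable {E : GradedOperad.{u, v, y} k C} (alg : Hom 𝒜 E)

/-! ### Composition with `s` and the key identity -/

section AnyDegree

variable {d d₁ d₂ d₄ : ℤ}

variable {R alg}

theorem isDer_comp_incl {θ : CollHom R.DR E d} (hθ : IsDer (R.ρDR.trans alg) θ) :
    IsDer (R.ρ.trans alg) (compHom R.incl θ) :=
  IsDer.congr_hom (f' := R.ρ.trans alg) (hθ.compHom (g := R.incl)) fun a =>
    congrArg alg.map (R.ρDR_incl a)

theorem comp_incl_eq_zero {θ : CollHom R.DR E d} (hθ : IsDer (R.ρDR.trans alg) θ)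
    (hX : ∀ {c : C} {l : List C} {n : ℤ} (g : R.X c l n), θ c l n (gen k (DRGen.x g)) = 0)
    {c : C} {l : List C} {n : ℤ} (a : R.operad.obj c l n) : θ c l n (R.incl.map a) = 0 := by
  have := IsDer.ext_gen (isDer_comp_incl hθ) (isDer_zero _)
    (fun g => (congrArg _ (R.incl_gen g)).trans (hX g))
  exact LinearMap.congr_fun (congrFun (congrFun (congrFun this c) l) n) a

theorem isDer_comp_s {θ : CollHom R.DR E d} (hθ : IsDer (R.ρDR.trans alg) θ) (h : d₁ = d + 1) :
    IsDer (R.ρ.trans alg) (compColl R.s h θ) :=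
  IsDer.congr_hom (f' := R.ρ.trans alg) (IsDer.compColl R.s_isDer hθ h fun a =>
    (congrArg alg.map (R.ρDR_s a)).trans (map_zero _)) fun a => congrArg alg.map (R.ρDR_incl a)

theorem isDer_comp_dDR {θ : CollHom R.DR E d} (hθ : IsDer (R.ρDR.trans alg) θ) (h : d₁ = d - 1) :
    IsDer (R.ρDR.trans alg) (codiff R.dDR E h θ) :=
  IsDer.compColl R.dDR_isDer hθ h fun a => (congrArg alg.map (R.ρDR_dDR a)).trans (map_zero _)

theorem isDer_comp_d {θ : CollHom R.operad E d} (hθ : IsDer (R.ρ.trans alg) θ) (h : d₁ = d - 1) :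
    IsDer (R.ρ.trans alg) (codiff R.d E h θ) :=
  IsDer.compColl R.d_isDer hθ h fun a => (congrArg alg.map (R.ρ_d _ _ _ a)).trans (map_zero _)

/-- On a generator `x` this is `θ` applied to `φ ∘₁ x - ∑ᵢ x ∘ᵢ φ - s(∂x)`. Since `θ` vanishes on
`X` and `φ` maps to `0` in `𝒜`, the first two terms give the inner derivation by `θ(φ)`. The degrees
are independent variables with equations because the applications produce unreduced expressions in
`w` and `n`. -/
theorem comp_s_comp_dDR {θ : CollHom R.DR E d} (hθ : IsDer (R.ρDR.trans alg) θ)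
    (hX : ∀ {c : C} {l : List C} {n : ℤ} (g : R.X c l n), θ c l n (gen k (DRGen.x g)) = 0)
    (h₂ : d₂ = d - 1) (h₁ : d₁ = d₂ + 1) (h₄ : d₄ = d + 1) (h₃ : d₁ = d₄ - 1) (h : d = d₁) :
    compColl R.s h₁ (codiff R.dDR E h₂ θ) =
      castColl h (innerDer (R.ρ.trans alg) d fun b => θ b [b] 0 (gen k (DRGen.phi b))) -
        codiff R.d E h₃ (compColl R.s h₄ θ) := by
  refine IsDer.ext_gen (isDer_comp_s (isDer_comp_dDR hθ h₂) h₁)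
    (IsDer.sub ((castColl_isDer h).2 (innerDer_isDer _ _))
      (isDer_comp_d (isDer_comp_s hθ h₄) h₃)) ?_
  intro c l n g
  have hφ : ∀ c, (R.ρDR.trans alg).map (gen k (DRGen.phi c)) = 0 := fun c =>
    (congrArg alg.map (R.ρDR_gen_phi c)).trans (map_zero _)
  have hx : (R.ρDR.trans alg).map (gen k (DRGen.x g)) = (R.ρ.trans alg).map (gen k g) :=
    congrArg alg.map (R.ρDR_gen_x g)
  rw [compColl_apply, s_gen, codiff_eq_compColl, compColl_apply, dDR_gen, Pi.sub_apply,
    Pi.sub_apply, Pi.sub_apply, LinearMap.sub_apply, castColl_apply, innerDer_apply, inner_apply,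
    codiff_eq_compColl, compColl_apply, compColl_apply]
  rw [dDRGen, map_sub (θ _ _ _), map_sub (θ _ _ _), hθ, hφ, hX, map_zero, smul_zero,
    add_zero, sumComp, hθ.map_sumCompFrom _ hφ, collHom_castDeg, hx]
  simp only [map_sub, map_smul, castDeg_comp, castDeg_castDeg, castDeg_sumCompFrom, sumComp]

/-- A derivation that vanishes on `X ⊕ Φ` is determined by its composition with `s`. -/
theorem eq_zero_of_comp_s {θ : CollHom R.DR E d} (hθ : IsDer (R.ρDR.trans alg) θ)
    (hX : ∀ {c : C} {l : List C} {n : ℤ} (g : R.X c l n), θ c l n (gen k (DRGen.x g)) = 0)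
    (hφ : ∀ c, θ c [c] 0 (gen k (DRGen.phi c)) = 0) (h : d₁ = d + 1)
    (hs : compColl R.s h θ = 0) : θ = 0 := by
  refine hθ.ext_gen (isDer_zero _) fun {c l m} g => ?_
  cases g with
  | x g => exact hX g
  | phi => exact hφ c
  | ux g =>
    have := LinearMap.congr_fun (congrFun (congrFun (congrFun hs c) l) _) (gen k g)
    rw [compColl_apply, s_gen] at this
    exact (castDeg_eq_zero _ _ _).1 this

theorem codiff_codiff (θ : CollHom R.operad E d) (h : d₁ = d - 1) (h' : d₂ = d₁ - 1) :
    codiff R.d E h' (codiff R.d E h θ) = 0 := by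
  funext c l n
  ext a
  rw [codiff_eq_compColl, codiff_eq_compColl, compColl_apply, compColl_apply, R.d_d]
  simp

/-- An inner derivation along `ρ.trans alg` factors through `ρ`, which kills boundaries. -/
theorem codiff_innerDer (U : ∀ c, E.obj c [c] (0 + d)) (h : d = d₁) (h' : d₂ = d₁ - 1) :
    codiff R.d E h' (castColl h (innerDer (R.ρ.trans alg) d U)) = 0 := by
  funext c l n
  ext a
  have : (R.ρ.trans alg).map (R.d c l n a) = 0 :=
    (congrArg alg.map (R.ρ_d c l n a)).trans (map_zero _)
  rw [codiff_eq_compColl, compColl_apply, castColl_apply, innerDer_apply, this]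
  simp

theorem codiff_phi (θ : CollHom R.DR E d) (h : d₁ = d - 1) (c : C) :
    codiff R.dDR E h θ c [c] 0 (gen k (DRGen.phi c)) = 0 := by
  rw [codiff_eq_compColl, compColl_apply, dDR_gen, dDRGen, map_zero, map_zero]

theorem codiff_x {θ : CollHom R.DR E d} (hθ : IsDer (R.ρDR.trans alg) θ)
    (hX : ∀ {c : C} {l : List C} {n : ℤ} (g : R.X c l n), θ c l n (gen k (DRGen.x g)) = 0)
    (h : d₁ = d - 1) {c : C} {l : List C} {n : ℤ} (g : R.X c l n) :
    codiff R.dDR E h θ c l n (gen k (DRGen.x g)) = 0 := by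
  rw [codiff_eq_compColl, compColl_apply, dDR_gen, dDRGen, comp_incl_eq_zero hθ hX, map_zero]

end AnyDegree

theorem ρ_alg_tj {c : C} {l : List C} {n : ℤ} (g : R.X c l n) (hg : R.tj g ≠ 0) :
    (R.ρ.trans alg).map (gen k g) = 0 :=
  (congrArg alg.map (R.ρ_tj g hg)).trans (map_zero _)

variable {R alg} {w : ℤ}

/-! ### Comparison of the augmented complex with the cotangent complex -/

section Cochains

variable {n : ℤ}

theorem augCochains_x {θ : CollHom R.DR E (w - n)} (hθ : θ ∈ R.augCochains alg w n) {c : C}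
    {l : List C} {m : ℤ} (g : R.X c l m) : θ c l m (gen k (DRGen.x g)) = 0 :=
  hθ.2 _ (.inl trivial)

theorem augCochains_phi {θ : CollHom R.DR E (w - n)} (hθ : θ ∈ R.augCochains alg w n) (hn : n ≠ 0)
    (c : C) : θ c [c] 0 (gen k (DRGen.phi c)) = 0 :=
  hθ.2 _ (.inr hn.symm)

variable (R E w n) in
/-- Composition with `s`, from the augmented complex to the cotangent complex. -/
noncomputable def compS : CollHom R.DR E (w - n) →ₗ[k] CollHom R.operad E (w - (n - 1)) :=
  compColl R.s (by omega)

theorem compS_gen (θ : CollHom R.DR E (w - n)) {c : C} {l : List C} {m : ℤ} (g : R.X c l m) :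
    compS R E w n θ c l m (gen k g) =
      E.castDeg (degree_shift_eq m w n)
        (θ c l (m + 1) (gen k (DRGen.ux g))) := by
  rw [← s_gen]; rfl

theorem compS_mem {θ : CollHom R.DR E (w - n)} (hθ : θ ∈ R.augCochains alg w n) :
    compS R E w n θ ∈ R.cochains alg w n := by
  refine ⟨isDer_comp_s hθ.1 _, fun g hg => ?_⟩
  rw [compS_gen, castDeg_eq_zero]
  exact hθ.2 _ (.inr fun h => hg (by rw [← h]; simp [DRGen.tjDeg]))

theorem compS_augδ {n' : ℤ} (hn : n' = n + 1) {θ : CollHom R.DR E (w - n)}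
    (hθ : θ ∈ R.augCochains alg w n) :
    compS R E w n' (R.augδ E w hn θ) =
      castColl (show w - n = w - (n' - 1) by omega) (innerDer (R.ρ.trans alg) (w - n)
        fun b => θ b [b] 0 (gen k (DRGen.phi b))) - R.δ E w hn (compS R E w n θ) :=
  comp_s_comp_dDR hθ.1 (augCochains_x hθ) _ _ _ _ _

theorem innerDer_phi_eq_zero {θ : CollHom R.DR E (w - n)} (hθ : θ ∈ R.augCochains alg w n)
    (hn : n ≠ 0) :
    innerDer (R.ρ.trans alg) (w - n) (fun b => θ b [b] 0 (gen k (DRGen.phi b))) = 0 := by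
  rw [← map_zero (innerDer (R.ρ.trans alg) (w - n))]
  congr 1
  funext b
  exact augCochains_phi hθ hn b

/-- `Φ` sits in TJ-degree `0`, so the bracket disappears. The remaining sign does not affect
cocycles or coboundaries. -/
theorem compS_augδ_of_ne {n' : ℤ} (hn : n' = n + 1) (h0 : n ≠ 0) {θ : CollHom R.DR E (w - n)}
    (hθ : θ ∈ R.augCochains alg w n) :
    compS R E w n' (R.augδ E w hn θ) = - R.δ E w hn (compS R E w n θ) := by
  rw [compS_augδ hn hθ, innerDer_phi_eq_zero hθ h0, map_zero, zero_sub]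

theorem cochains_tjPart {η : CollHom R.operad E (w - (n - 1))} (hη : η ∈ R.cochains alg w n)
    {i : ℤ} (hi : i ≠ n - 1) {c : C} {l : List C} {m : ℤ} {a : R.operad.obj c l m}
    (ha : a ∈ tjPart k R.tj i c l m) : η c l m a = 0 :=
  IsDer.tjPart_eq_zero hη.1 (R.ρ_alg_tj alg) hη.2 hi ha

/-- The differential of `g` lies in TJ-degree `tj g - 1`, and `η` is nonzero only on TJ-degree `n -
1`. -/
theorem δ_gen {n' : ℤ} (hn : n' = n + 1) {η : CollHom R.operad E (w - (n - 1))}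
    (hη : η ∈ R.cochains alg w n) {c : C} {l : List C} {m : ℤ} (g : R.X c l m)
    (hg : (R.tj g : ℤ) ≠ n) : R.δ E w hn η c l m (gen k g) = 0 := by
  rw [δ, codiff_eq_compColl, compColl_apply, cochains_tjPart hη (by omega) (R.d_tj g), map_zero]

theorem δ_mem {n' : ℤ} (hn : n' = n + 1) {η : CollHom R.operad E (w - (n - 1))}
    (hη : η ∈ R.cochains alg w n) : R.δ E w hn η ∈ R.cochains alg w n' :=
  ⟨isDer_comp_d hη.1 _, fun g hg => δ_gen hn hη g (by omega)⟩

theorem augδ_mem {n' : ℤ} (hn : n' = n + 1) {θ : CollHom R.DR E (w - n)}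
    (hθ : θ ∈ R.augCochains alg w n) : R.augδ E w hn θ ∈ R.augCochains alg w n' := by
  refine ⟨isDer_comp_dDR hθ.1 _, fun {c l m} g hg => ?_⟩
  cases g with
  | x g => exact codiff_x hθ.1 (augCochains_x hθ) _ g
  | phi => exact codiff_phi _ _ c
  | ux g =>
    have hg' : (R.tj g : ℤ) ≠ n := fun h => hg.elim id fun h' => h' (by
      rw [hn, ← h]; simp [DRGen.tjDeg])
    have h := compS_gen (R.augδ E w hn θ) g
    rw [compS_augδ hn hθ, Pi.sub_apply, Pi.sub_apply, Pi.sub_apply, LinearMap.sub_apply,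
      δ_gen hn (compS_mem hθ) g hg', sub_zero] at h
    refine (castDeg_eq_zero _ _ _).1 (h.symm.trans ?_)
    -- For `n = 0` the bracket need not vanish, but `tj g ≠ 0`, so `ρ` already kills `g`. For `n ≠
    -- 0` the values on `Φ` are zero.
    by_cases h0 : n = 0
    · rw [castColl_apply, innerDer_apply, R.ρ_alg_tj alg g (by omega), map_zero, map_zero]
    · rw [innerDer_phi_eq_zero hθ h0, map_zero]
      rfl

/-- It is enough to compose with `s`, since the double differential vanishes on `X` and on `Φ`. Two
applications of the key identity leave `δ` of an inner derivation and `δ²` on `F(X)`, both zero. -/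
theorem augδ_augδ {n' n'' : ℤ} (hn : n' = n + 1) (hn' : n'' = n' + 1)
    {θ : CollHom R.DR E (w - n)} (hθ : θ ∈ R.augCochains alg w n) :
    R.augδ E w hn' (R.augδ E w hn θ) = 0 := by
  have h₁ := augδ_mem hn hθ
  refine eq_zero_of_comp_s (augδ_mem hn' h₁).1 (augCochains_x (augδ_mem hn' h₁))
    (codiff_phi _ _) (d₁ := w - (n'' - 1)) (by omega) ?_
  refine (compS_augδ hn' h₁).trans ?_
  rw [compS_augδ hn hθ, map_sub]
  have e₁ : innerDer (R.ρ.trans alg) (w - n')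
      (fun b => R.augδ E w hn θ b [b] 0 (gen k (DRGen.phi b))) = 0 := by
    rw [← map_zero (innerDer (R.ρ.trans alg) (w - n'))]
    congr 1
    funext b
    exact codiff_phi _ _ b
  rw [e₁, map_zero, δ, δ, codiff_codiff, codiff_innerDer, sub_self, sub_self]

theorem eq_zero_of_compS {θ : CollHom R.DR E (w - n)} (hθ : θ ∈ R.augCochains alg w n)
    (hn : n ≠ 0) (h : compS R E w n θ = 0) : θ = 0 :=
  eq_zero_of_comp_s hθ.1 (augCochains_x hθ) (augCochains_phi hθ hn) _ h

/-- Values on `↑X` can be prescribed freely: take those of `η` there, and `0` on `X` and `Φ`. -/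
theorem exists_compS_eq {η : CollHom R.operad E (w - (n - 1))} (hη : η ∈ R.cochains alg w n) :
    ∃ θ ∈ R.augCochains alg w n, compS R E w n θ = η := by
  let φ : ∀ (c : C) (l : List C) (m : ℤ), DRGen R.X c l m → E.obj c l (m + (w - n)) := fun
    | _, _, _, .x _ => 0
    | _, _, _, .phi _ => 0
    | c, l, _, .ux (n := m) g =>
      E.castDeg (show m + (w - (n - 1)) = m + 1 + (w - n) by omega) (η c l m (gen k g))
  have hmem : derExt (R.ρDR.trans alg) (w - n) φ ∈ R.augCochains alg w n := by
    refine ⟨derExt_isDer _ _ _, fun g hg => ?_⟩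
    rw [derExt_gen]
    cases g with
    | x g => rfl
    | phi => rfl
    | ux g =>
      refine (castDeg_eq_zero _ _ _).2 (hη.2 g fun h => hg.elim id fun h' => h' ?_)
      simp only [DRGen.tjDeg]
      omega
  refine ⟨_, hmem, IsDer.ext_gen (compS_mem hmem).1 hη.1 fun g => ?_⟩
  rw [compS_gen, derExt_gen, castDeg_castDeg]
  rfl

end Cochains

/-! ### Cocycles in nonzero degrees and cohomology from degree two on -/

variable (R alg w) in
/-- Composition with `s` identifies the cocycles in positive degrees. -/
noncomputable def compSEquiv (n : ℤ) (hn : n ≠ 0) (hn' : n ≠ -1) :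
    R.augCocycles alg w n ≃ₗ[k] R.cocycles alg w n :=
  LinearEquiv.ofBijective
    ((compS R E w n).restrict (p := R.augCocycles alg w n) (q := R.cocycles alg w n)
      fun θ hθ => ⟨compS_mem hθ.1, by
      have h := compS_augδ_of_ne (rfl : n + 1 = n + 1) hn hθ.1
      rw [LinearMap.mem_ker.1 hθ.2, map_zero] at h
      exact LinearMap.mem_ker.2 (neg_eq_zero.1 h.symm)⟩) (by
    constructor
    · rw [injective_iff_map_eq_zero]
      intro θ h
      exact Subtype.ext (eq_zero_of_compS θ.2.1 hn (congrArg Subtype.val h))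
    · intro η
      obtain ⟨θ, hθ, h⟩ := exists_compS_eq η.2.1
      refine ⟨⟨θ, hθ, ?_⟩, Subtype.ext h⟩
      -- Injectivity is used in degree `n + 1`, which is why `n = -1` is excluded.
      refine LinearMap.mem_ker.2 (eq_zero_of_compS (augδ_mem rfl hθ) (by omega) ?_)
      rw [compS_augδ_of_ne _ hn hθ, h, LinearMap.mem_ker.1 η.2.2, neg_zero])

/-- With `n - 1 ≠ 0` the comparison also anticommutes with the differential entering degree `n`, and
it is onto in degree `n - 1`. Primitives correspond up to sign. -/
theorem map_compSEquiv_coboundaries {n : ℤ} (hn : 2 ≤ n) :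
    (((R.augCochains alg w (n - 1)).map (R.augδ E w (sub_add_cancel n 1).symm)).submoduleOf
      (R.augCocycles alg w n)).map (compSEquiv R alg w n (by omega) (by omega)).toLinearMap =
    ((R.cochains alg w (n - 1)).map (R.δ E w (sub_add_cancel n 1).symm)).submoduleOf
      (R.cocycles alg w n) := by
  ext η
  constructor
  · rintro ⟨θ, ⟨ξ, hξ, h⟩, rfl⟩
    refine ⟨-compS R E w (n - 1) ξ, Submodule.neg_mem _ (compS_mem hξ), ?_⟩
    rw [map_neg, ← compS_augδ_of_ne _ (by omega) hξ, h]
    rfl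
  · rintro ⟨ζ, hζ, h⟩
    obtain ⟨ξ, hξ, rfl⟩ := exists_compS_eq hζ
    have e : compS R E w n (R.augδ E w (sub_add_cancel n 1).symm (-ξ)) = η := by
      rw [map_neg, map_neg, compS_augδ_of_ne _ (by omega) hξ, neg_neg, h]
      rfl
    refine ⟨(compSEquiv R alg w n (by omega) (by omega)).symm η, ⟨-ξ, Submodule.neg_mem _ hξ, ?_⟩,
      LinearEquiv.apply_symm_apply _ _⟩
    have hm := augδ_mem (sub_add_cancel n 1).symm (Submodule.neg_mem _ hξ)
    refine sub_eq_zero.1 (eq_zero_of_compS (Submodule.sub_mem _ hm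
      ((compSEquiv R alg w n (by omega) (by omega)).symm η).2.1) (by omega) ?_)
    rw [map_sub, e]
    refine sub_eq_zero.2 (congrArg Subtype.val
      (LinearEquiv.apply_symm_apply (compSEquiv R alg w n (by omega) (by omega)) η)).symm

/-! ### Cochains in degrees at most zero -/

theorem augCochains_eq_bot {n : ℤ} (hn : n ≤ -1) : R.augCochains alg w n = ⊥ := by
  refine (Submodule.eq_bot_iff _).2 fun θ hθ => IsDer.ext_gen hθ.1 (isDer_zero _) fun g => ?_
  exact hθ.2 g (.inr (by omega))

/-- Suspended generators have TJ-degree at least `1`, so outside `X` having nonzero TJ-degree means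
lying in `↑X`. -/
theorem augCochains_zero : R.augCochains alg w 0 =
    derVanishing (R.ρDR.trans alg) (w - 0) (fun g => g.IsX ∨ g.IsUX) := by
  ext θ
  refine and_congr_right fun _ => forall_congr' fun c => forall_congr' fun l =>
    forall_congr' fun m => forall_congr' fun g => imp_congr ?_ Iff.rfl
  cases g <;> simp [DRGen.IsX, DRGen.IsUX, DRGen.tjDeg]
  omega

/-- The derivations in degree zero are determined by their values on `Φ`. -/
theorem exists_augCochains_zero {n : ℤ} (hn : n = 0) (U : ∀ c, E.obj c [c] (0 + (w - n))) :
    ∃ θ ∈ R.augCochains alg w n, ∀ c, θ c [c] 0 (gen k (DRGen.phi c)) = U c := by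
  let φ : ∀ (c : C) (l : List C) (m : ℤ), DRGen R.X c l m → E.obj c l (m + (w - n)) := fun
    | _, _, _, .x _ => 0
    | _, _, _, .phi c => U c
    | _, _, _, .ux _ => 0
  refine ⟨derExt (R.ρDR.trans alg) (w - n) φ, ⟨derExt_isDer _ _ _, fun g hg => ?_⟩,
    fun c => derExt_gen _ _ _ _⟩
  rw [derExt_gen]
  cases g with
  | x g => rfl
  | phi => exact (hg.elim id fun h => h hn.symm).elim
  | ux g => rfl

theorem augCochains_zero_ext {θ : CollHom R.DR E (w - 0)} (hθ : θ ∈ R.augCochains alg w 0)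
    (h : ∀ c, θ c [c] 0 (gen k (DRGen.phi c)) = 0) : θ = 0 := by
  rw [augCochains_zero] at hθ
  refine IsDer.ext_gen hθ.1 (isDer_zero _) fun {c l m} g => ?_
  cases g with
  | x g => exact hθ.2 _ (.inl trivial)
  | phi => exact h c
  | ux g => exact hθ.2 _ (.inr trivial)

/-- The augmented cochains in degree zero, as collections of unary operations. -/
noncomputable def augCochainsZeroEquiv : R.augCochains alg w 0 ≃ₗ[k] (∀ c, E.obj c [c] w) :=
  LinearEquiv.ofBijective
    (LinearMap.pi fun c => (E.castDeg (degree_zero_eq w) ∘ₗ LinearMap.applyₗ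
      (gen k (DRGen.phi c)) ∘ₗ LinearMap.proj (R := k) 0 ∘ₗ LinearMap.proj (R := k) [c] ∘ₗ
        LinearMap.proj (R := k) c) ∘ₗ (R.augCochains alg w 0).subtype) (by
    constructor
    · rw [injective_iff_map_eq_zero]
      intro θ h
      exact Subtype.ext (augCochains_zero_ext θ.2 fun c =>
        (castDeg_eq_zero _ _ _).1 (congrFun h c))
    · intro U
      obtain ⟨θ, hθ, h⟩ := exists_augCochains_zero (R := R) (alg := alg) rfl
        fun c => E.castDeg (show w = 0 + (w - 0) by omega) (U c)
      refine ⟨⟨θ, hθ⟩, funext fun c => ?_⟩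
      exact (congrArg (E.castDeg _) (h c)).trans (castDeg_castDeg _ _ _ _))

/-- No generator has the negative TJ-degree `n - 1`. For `n = 0` this leaves only `Φ` to contribute
coboundaries in augmented degree one. -/
theorem cochains_eq_zero {n : ℤ} (hn : n ≤ 0) {η : CollHom R.operad E (w - (n - 1))}
    (hη : η ∈ R.cochains alg w n) : η = 0 :=
  IsDer.ext_gen hη.1 (isDer_zero _) fun g => hη.2 g (by omega)

end TJResolution

/-! ### Infinitesimal deformations and inner derivations -/

section Deformations

variable {𝒜 : GradedOperad.{u, v, w} k C} {E : GradedOperad.{u, v, y} k C} {alg : Hom 𝒜 E} {w : ℤ}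

theorem mem_deformations_iff {D : CollHom 𝒜 E w} : D ∈ deformations alg w ↔ IsDer alg D :=
  (isDeformation_iff alg D).trans ⟨And.right, fun h => ⟨h.map_one, h⟩⟩

/-- As `ε² = 0`, only terms with a single `ε U` survive; moving `ε` past `a` produces the sign
`(-1)^(wn)`. -/
theorem compAllFrom_dual (U : ∀ c, E.obj c [c] (0 + w)) {c : C} {l : List C} {n : ℤ}
    (a : E.obj c l n) (a' : E.obj c l (n + w)) (l₁ l₂ : List C) (h : l = l₁ ++ l₂) :
    (E.dual w).compAllFrom (fun b => (E.one b, U b)) l₁ l₂ h (a, a') =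
      (a, a' + ksgn k (w * n) • E.sumCompFrom U (show n + w = n + (0 + w) by omega) a l₁ l₂ h) := by
  induction l₂ generalizing l₁ a' with
  | nil => rw [sumCompFrom_nil, smul_zero, add_zero]; rfl
  | cons b l₂ ih =>
    have e : (E.dual w).comp l₁ l₂ h h (add_zero n).symm (a, a') (E.one b, U b) =
        (a, a' + ksgn k (w * n) • E.comp l₁ l₂ h h (show n + w = n + (0 + w) by omega) a (U b)) :=
      Prod.ext (E.comp_one l₁ l₂ h h _ a)
        (congrArg (· + _) (E.comp_one l₁ l₂ h h _ a'))
    rw [sumCompFrom_cons, smul_add, ← add_assoc, ← ih, ← e]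
    rfl

/-- The coefficient of `ε` in the defining equation is `U ∘ α(a) + D a = D' a ± ∑ᵢ α(a) ∘ᵢ U`; the
constant terms always agree. -/
theorem defEquiv_iff {D D' : CollHom 𝒜 E w} :
    DefEquiv alg D D' ↔ ∃ U, D' - D = innerDer alg w U := by
  refine exists_congr fun U => ?_
  have key : ∀ (c : C) (l : List C) (n : ℤ) (a : 𝒜.obj c l n),
      ((E.dual w).comp [] [] (show [c] = [] ++ c :: [] from rfl) (by simp)
        (show n = 0 + n by omega) (E.one c, U c) (alg.map a, D c l n a) =
      (E.dual w).compAll (fun b => (E.one b, U b)) (alg.map a, D' c l n a)) ↔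
      (D' - D) c l n a = innerDer alg w U c l n a := by
    intro c l n a
    have e : (E.dual w).comp [] [] (show [c] = [] ++ c :: [] from rfl) (by simp)
        (show n = 0 + n by omega) (E.one c, U c) (alg.map a, D c l n a) =
      (alg.map a, E.comp [] [] (show [c] = [] ++ c :: [] from rfl) (by simp)
        (show n + w = 0 + w + n by omega) (U c) (alg.map a) + D c l n a) := by
      refine Prod.ext (E.one_comp _ _ _ _) (congrArg (_ + ·) ?_)
      change ksgn k (w * 0) • E.comp _ _ _ _ _ (E.one c) (D c l n a) = _
      rw [mul_zero, ksgn_zero, one_smul]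
      exact E.one_comp _ _ _ _
    have e' : (E.dual w).compAll (fun b => (E.one b, U b)) (alg.map a, D' c l n a) = _ :=
      compAllFrom_dual U (alg.map a) (D' c l n a) [] l rfl
    rw [e, e']
    refine (Prod.mk_right_injective (alg.map a)).eq_iff.trans ?_
    rw [innerDer_apply, inner_apply, sumComp]
    simp only [Pi.sub_apply, LinearMap.sub_apply]
    rw [sub_eq_sub_iff_add_eq_add, eq_comm]
  constructor
  · intro h
    funext c l n
    ext a
    exact (key c l n a).1 (h c l n a)
  · intro h c l n a
    exact (key c l n a).2 (by rw [h])

/-- Differences of related deformations are inner. Conversely, an inner derivation is the difference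
of itself and the related deformation `0`, so these differences already form a submodule. -/
theorem defEquivSpan_eq :
    defEquivSpan alg w = (LinearMap.range (innerDer alg w)).submoduleOf (deformations alg w) := by
  refine le_antisymm (Submodule.span_le.2 ?_) fun D hD => Submodule.subset_span ⟨D, 0, ?_, ?_⟩
  · rintro _ ⟨D, D', h, rfl⟩
    obtain ⟨U, hU⟩ := defEquiv_iff.1 h
    refine ⟨-U, ?_⟩
    rw [map_neg, ← hU, neg_sub]
    rfl
  · obtain ⟨U, hU⟩ := hD
    refine defEquiv_iff.2 ⟨-U, ?_⟩
    rw [map_neg, hU, Submodule.coe_zero, zero_sub]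
    rfl
  · rw [sub_zero]

theorem mkQ_eq_mkQ_iff_defEquiv (D D' : deformations alg w) :
    (defEquivSpan alg w).mkQ D = (defEquivSpan alg w).mkQ D' ↔ DefEquiv alg D.1 D'.1 := by
  rw [Submodule.mkQ_apply, Submodule.mkQ_apply, Submodule.Quotient.eq, defEquivSpan_eq,
    defEquiv_iff]
  constructor
  · rintro ⟨U, hU⟩
    refine ⟨-U, ?_⟩
    rw [map_neg, hU]
    exact (neg_sub D.1 D'.1).symm
  · rintro ⟨U, hU⟩
    refine ⟨-U, ?_⟩
    rw [map_neg, ← hU]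
    exact neg_sub D'.1 D.1

theorem castColl_innerDer {f : Hom 𝒜 E} {d d' : ℤ} (h : d = d') (U : ∀ c, E.obj c [c] (0 + d)) :
    castColl h (innerDer f d U) =
      innerDer f d' fun c => E.castDeg (show 0 + d = 0 + d' by rw [h]) (U c) := by
  subst h; rfl

/-- Over a field the surjection `f` has a linear section; `g` composed with it is the factorisation.
-/
theorem LinearMap.exists_comp_eq_of_ker_le {M N P : Type*} [AddCommGroup M] [AddCommGroup N]
    [AddCommGroup P] [Module k M] [Module k N] [Module k P] {f : M →ₗ[k] N} {g : M →ₗ[k] P}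
    (hf : Function.Surjective f) (h : ∀ a, f a = 0 → g a = 0) :
    ∃ φ : N →ₗ[k] P, ∀ a, φ (f a) = g a := by
  obtain ⟨σ, hσ⟩ := f.exists_rightInverse_of_surjective (LinearMap.range_eq_top.2 hf)
  refine ⟨g ∘ₗ σ, fun a => sub_eq_zero.1 ?_⟩
  rw [LinearMap.comp_apply, ← map_sub]
  refine h _ ?_
  rw [map_sub, ← LinearMap.comp_apply, hσ, LinearMap.id_apply, sub_self]

/-! ### Degree one: cocycles are deformations, coboundaries are inner -/

namespace TJResolution

variable (R : TJResolution.{u, v, w, x} 𝒜)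

theorem ρ_surjective (c : C) (l : List C) (n : ℤ) :
    Function.Surjective (R.ρ.map (c := c) (l := l) (n := n)) := fun a =>
  let ⟨z, _, hz⟩ := R.quism_surj c l n a
  ⟨z, hz⟩

/-- A derivation of `TJ`-degree zero that kills the boundaries vanishes on the kernel of `ρ`. -/
theorem eq_zero_of_ρ_eq_zero {d : ℤ} {η : CollHom R.operad E d} (hη : IsDer (R.ρ.trans alg) η)
    (h0 : ∀ {c : C} {l : List C} {n : ℤ} (g : R.X c l n), (R.tj g : ℤ) ≠ 0 → η c l n (gen k g) = 0)
    (hd : ∀ (c : C) (l : List C) (n : ℤ) (a : R.operad.obj c l n),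
      η c l (n + -1) (R.d c l n a) = 0)
    {c : C} {l : List C} {n : ℤ} (a : R.operad.obj c l n) (ha : R.ρ.map a = 0) :
    η c l n a = 0 := by
  -- Both `ρ` and `η` vanish on monomials of positive TJ-degree, so `a` may be replaced by its part
  -- `a₀` of degree zero. That part is a boundary by injectivity of `H₀(ρ)`.
  obtain ⟨a₀, h₀, h⟩ := exists_tjPart_zero R.tj a
  have h₁ : R.ρ.map a₀ = 0 :=
    (map_eq_of_sub_mem_span h R.ρ.map fun X hX =>
      R.ρ.map_monomial_eq_zero R.ρ_tj X hX).symm.trans ha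
  rw [map_eq_of_sub_mem_span h (η c l n) fun X hX =>
    hη.monomial_eq_zero (R.ρ_alg_tj alg) h0 X (by exact_mod_cast hX)]
  obtain ⟨b, -, rfl⟩ := R.h0_inj c l n a₀ h₀ h₁
  rw [collHom_castDeg, hd, map_zero]

variable (alg w) in
/-- Composition with `ρ` identifies the deformations with the cocycles in degree one. -/
noncomputable def deformationsEquiv : deformations alg w ≃ₗ[k] R.cocycles alg w 1 :=
  LinearEquiv.ofBijective
    (((castColl (show w = w - (1 - 1) by omega)).toLinearMap ∘ₗ compHom R.ρ).restrict
      (p := deformations alg w) (q := R.cocycles alg w 1) fun D hD => by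
        have h : IsDer (R.ρ.trans alg)
            (castColl (show w = w - (1 - 1) by omega) (compHom R.ρ D)) :=
          (castColl_isDer _).2 (IsDer.compHom (mem_deformations_iff.1 hD))
        refine ⟨⟨h, fun g hg => ?_⟩,
          LinearMap.mem_ker.2 ?_⟩
        · refine (castDeg_eq_zero _ _ _).2 ?_
          rw [compHom_apply, R.ρ_tj g (by simpa using hg), map_zero]
        · funext c l n
          ext a
          change E.castDeg _ (E.castDeg _ (D c l (n + -1) (R.ρ.map (R.d c l n a)))) = 0
          rw [R.ρ_d, map_zero, map_zero, map_zero]) (by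
    constructor
    · rw [injective_iff_map_eq_zero]
      intro D h
      refine Subtype.ext ?_
      funext c l n
      ext a
      obtain ⟨z, rfl⟩ := R.ρ_surjective c l n a
      exact (castDeg_eq_zero _ _ _).1 (LinearMap.congr_fun (congrFun (congrFun (congrFun
        (congrArg Subtype.val h) c) l) n) z)
    · rintro ⟨η, hη, hδ⟩
      obtain ⟨η, rfl⟩ := (castColl (show w = w - (1 - 1) by omega)).surjective η
      have hη' : IsDer (R.ρ.trans alg) η := (castColl_isDer _).1 hη.1
      have h0 : ∀ {c : C} {l : List C} {n : ℤ} (g : R.X c l n), (R.tj g : ℤ) ≠ 0 →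
          η c l n (gen k g) = 0 := fun g hg =>
        (castDeg_eq_zero _ _ _).1 (hη.2 g (by simpa using hg))
      have hd : ∀ (c : C) (l : List C) (n : ℤ) (a : R.operad.obj c l n),
          η c l (n + -1) (R.d c l n a) = 0 := fun c l n a =>
        (castDeg_eq_zero _ _ _).1 ((castDeg_eq_zero _ _ _).1 (LinearMap.congr_fun (congrFun
          (congrFun (congrFun (LinearMap.mem_ker.1 hδ) c) l) n) a))
      -- The cocycle vanishes on the kernel of `ρ`, so it descends along `ρ`. The Leibniz rule for
      -- `D` is then checked on lifts.
      choose D hD using fun c l n => LinearMap.exists_comp_eq_of_ker_le (R.ρ_surjective c l n)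
        (R.eq_zero_of_ρ_eq_zero hη' h0 hd)
      refine ⟨⟨D, mem_deformations_iff.2 ?_⟩, Subtype.ext (congrArg (castColl _) ?_)⟩
      · intro c b e m g p q r l₁ l₂ he hg hr a a'
        obtain ⟨z, rfl⟩ := R.ρ_surjective _ _ _ a
        obtain ⟨z', rfl⟩ := R.ρ_surjective _ _ _ a'
        rw [← R.ρ.map_comp, hD, hD, hD, hη' l₁ l₂ he hg hr]
        rfl
      · funext c l n
        ext a
        exact hD c l n a)

theorem deformationsEquiv_coe (D : deformations alg w) :
    (R.deformationsEquiv alg w D).1 =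
      castColl (show w = w - (1 - 1) by omega) (compHom R.ρ D.1) := rfl

variable (alg w) in
/-- Augmented cocycles in degree one are deformations. -/
noncomputable def augCocyclesOneEquiv : R.augCocycles alg w 1 ≃ₗ[k] deformations alg w :=
  (compSEquiv R alg w 1 (by omega) (by omega)).trans (R.deformationsEquiv alg w).symm

theorem castColl_comp_augCocyclesOneEquiv (θ : R.augCocycles alg w 1) :
    castColl (show w = w - (1 - 1) by omega)
      (compHom R.ρ (R.augCocyclesOneEquiv alg w θ).1) = compS R E w 1 θ.1 :=
  congrArg Subtype.val ((R.deformationsEquiv alg w).apply_symm_apply _)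

theorem augCocyclesOneEquiv_gen (θ : R.augCocycles alg w 1) {c : C} {l : List C} {n : ℤ}
    (g : R.X c l n) : (R.augCocyclesOneEquiv alg w θ).1 c l n (R.ρ.map (gen k g)) =
      E.castDeg (degree_one_eq n w)
        (θ.1 c l (n + 1) (gen k (DRGen.ux g))) := by
  have h := LinearMap.congr_fun (congrFun (congrFun (congrFun
    (R.castColl_comp_augCocyclesOneEquiv θ) c) l) n) (gen k g)
  rw [compS_gen, castColl_apply, castDeg_eq_iff, castDeg_castDeg] at h
  exact h

/-- In the key identity the term `δ(ξ ∘ s)` drops out because there are no cochains of degree zero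
on `F(X)`. What remains is the inner derivation by `ξ(φ)`, pulled back along `ρ`. -/
theorem compS_augδ_zero {ξ : CollHom R.DR E (w - (1 - 1))} (hξ : ξ ∈ R.augCochains alg w (1 - 1)) :
    compS R E w 1 (R.augδ E w (sub_add_cancel 1 1).symm ξ) =
      castColl (show w = w - (1 - 1) by omega) (compHom R.ρ (innerDer alg w fun b =>
        E.castDeg (show 0 + (w - (1 - 1)) = 0 + w by omega)
          (ξ b [b] 0 (gen k (DRGen.phi b))))) := by
  rw [compS_augδ _ hξ, cochains_eq_zero (by omega) (compS_mem hξ), map_zero, sub_zero]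
  change _ = castColl _ (innerDer (R.ρ.trans alg) w _)
  rw [castColl_innerDer, castColl_innerDer]
  simp only [castDeg_castDeg]

/-- A coboundary gives the inner derivation by the values of its primitive on `Φ`, and every family
`U` occurs as such values. -/
theorem map_augCocyclesOneEquiv_coboundaries :
    (((R.augCochains alg w (1 - 1)).map (R.augδ E w (sub_add_cancel 1 1).symm)).submoduleOf
      (R.augCocycles alg w 1)).map (R.augCocyclesOneEquiv alg w).toLinearMap =
    defEquivSpan alg w := by
  rw [defEquivSpan_eq]
  ext D
  constructor
  · rintro ⟨θ, ⟨ξ, hξ, h⟩, rfl⟩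
    have e : R.deformationsEquiv alg w (R.augCocyclesOneEquiv alg w θ) =
        R.deformationsEquiv alg w ⟨_, mem_deformations_iff.2 (innerDer_isDer alg _)⟩ :=
      Subtype.ext ((R.castColl_comp_augCocyclesOneEquiv θ).trans
        ((congrArg (compS R E w 1) h.symm).trans (R.compS_augδ_zero hξ)))
    exact ⟨_, congrArg Subtype.val ((R.deformationsEquiv alg w).injective e).symm⟩
  · rintro ⟨U, hU⟩
    -- The incoming degree appears as `1 - 1`, not as the literal `0`; hence the equation `sub_self
    -- 1`.
    obtain ⟨ξ, hξ, h⟩ := exists_augCochains_zero (R := R) (alg := alg) (sub_self 1)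
      fun c => E.castDeg (show 0 + w = 0 + (w - (1 - 1)) by omega) (U c)
    have hU' := R.compS_augδ_zero hξ
    simp only [h, castDeg_castDeg] at hU'
    refine ⟨⟨R.augδ E w (sub_add_cancel 1 1).symm ξ, augδ_mem _ hξ,
      LinearMap.mem_ker.2 (augδ_augδ _ _ hξ)⟩, ⟨ξ, hξ, rfl⟩, ?_⟩
    refine (R.deformationsEquiv alg w).injective (Subtype.ext ?_)
    refine (R.castColl_comp_augCocyclesOneEquiv _).trans (hU'.trans ?_)
    rw [deformationsEquiv_coe]
    congr 2

end TJResolution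

end Deformations

end ResolutionLemmas

/-! ### The theorem for the endomorphism operad -/

theorem mainTheorem5 {k : Type u} [Field k] [CharZero k] {C : Type v}
    (𝒜 : GradedOperad.{u, v, w} k C) (R : TJResolution.{u, v, w, x} 𝒜)
    (A : C → ℤ → Type y) [∀ c n, AddCommGroup (A c n)] [∀ c n, Module k (A c n)]
    (alg : GradedOperad.Hom 𝒜 (endOperad k A)) (w : ℤ) :
    -- the cotangent complexes are complexes
    (∀ n : ℤ, ∀ θ ∈ R.augCochains alg w n,
      R.augδ (endOperad k A) w (rfl : n + 1 = n + 1) θ ∈ R.augCochains alg w (n + 1) ∧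
      R.augδ (endOperad k A) w (rfl : n + 1 + 1 = n + 1 + 1)
        (R.augδ (endOperad k A) w (rfl : n + 1 = n + 1) θ) = 0) ∧
    (∀ n : ℤ, ∀ θ ∈ R.cochains alg w n,
      R.δ (endOperad k A) w (rfl : n + 1 = n + 1) θ ∈ R.cochains alg w (n + 1) ∧
      R.δ (endOperad k A) w (rfl : n + 1 + 1 = n + 1 + 1)
        (R.δ (endOperad k A) w (rfl : n + 1 = n + 1) θ) = 0) ∧
    -- vanishing in negative degrees
    (∀ n : ℤ, n ≤ -1 → R.augCochains alg w n = ⊥) ∧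
    -- degree zero
    (R.augCochains alg w 0 =
        derVanishing (R.ρDR.trans alg) (w - 0) (fun g => g.IsX ∨ g.IsUX) ∧
      ∃ e : R.augCochains alg w 0 ≃ₗ[k] (∀ (c : C) (p : ℤ), A c p →ₗ[k] A c (w + p)),
        ∀ (θ : R.augCochains alg w 0) (c : C),
          e θ c = (endOperad k A).castDeg (show 0 + (w - 0) = w by omega)
            (θ.1 c [c] 0 (FreeOperad.gen k (DRGen.phi c)))) ∧
    -- degree one
    ((∀ D D' : deformations alg w,
        (defEquivSpan alg w).mkQ D = (defEquivSpan alg w).mkQ D' ↔ DefEquiv alg D.1 D'.1) ∧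
      ∃ e : R.augCohomology alg w 1 ≃ₗ[k] (deformations alg w ⧸ defEquivSpan alg w),
        ∀ θ : R.augCocycles alg w 1, ∃ D : deformations alg w,
          (∀ (c : C) (l : List C) (n : ℤ) (g : R.X c l n),
            D.1 c l n (R.ρ.map (FreeOperad.gen k g)) =
              (endOperad k A).castDeg (show n + 1 + (w - 1) = n + w by omega)
                (θ.1 c l (n + 1) (FreeOperad.gen k (DRGen.ux g)))) ∧
          e (Submodule.Quotient.mk θ) = Submodule.Quotient.mk D) ∧
    -- degrees at least two
    (∀ n : ℤ, 2 ≤ n →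
      ∃ e : R.augCohomology alg w n ≃ₗ[k] R.cohomology alg w n,
        ∀ θ : R.augCocycles alg w n, ∃ θ' : R.cocycles alg w n,
          (∀ (c : C) (l : List C) (m : ℤ) (g : R.X c l m),
            θ'.1 c l m (FreeOperad.gen k g) =
              (endOperad k A).castDeg (show m + 1 + (w - n) = m + (w - (n - 1)) by omega)
                (θ.1 c l (m + 1) (FreeOperad.gen k (DRGen.ux g)))) ∧
          e (Submodule.Quotient.mk θ) = Submodule.Quotient.mk θ') := by
  refine ⟨fun n θ hθ => ⟨TJResolution.augδ_mem _ hθ, TJResolution.augδ_augδ _ _ hθ⟩,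
    fun n θ hθ => ⟨TJResolution.δ_mem _ hθ, TJResolution.codiff_codiff _ _ _⟩,
    fun n hn => TJResolution.augCochains_eq_bot hn,
    -- Unary operations of degree `w` in the endomorphism operad unfold definitionally to families
    -- `A c p →ₗ[k] A c (w + p)`.
    ⟨TJResolution.augCochains_zero, TJResolution.augCochainsZeroEquiv, fun θ c => rfl⟩,
    ⟨mkQ_eq_mkQ_iff_defEquiv, ?_⟩, fun n hn => ?_⟩
  · refine ⟨Submodule.Quotient.equiv _ _ (R.augCocyclesOneEquiv alg w)
      R.map_augCocyclesOneEquiv_coboundaries, fun θ => ⟨R.augCocyclesOneEquiv alg w θ,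
      fun c l n g => R.augCocyclesOneEquiv_gen θ g, rfl⟩⟩
  · refine ⟨Submodule.Quotient.equiv _ _
      (TJResolution.compSEquiv R alg w n (by omega) (by omega))
      (TJResolution.map_compSEquiv_coboundaries hn), fun θ =>
      ⟨TJResolution.compSEquiv R alg w n (by omega) (by omega) θ,
      fun c l m g => TJResolution.compS_gen θ.1 g, rfl⟩⟩
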